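/- Let $B\subset A$ be a unital inclusion of unital $C^*$-algebras, $\tau$ a faithful tracial state on $A$ and $E:A\to B$ a $\tau$-preserving conditional expectation. Let $\eta_1,\dots,\eta_d:B\to B$ be completely positive maps and let $S=(S_1,\dots,S_d)$ be self-adjoint elements of $A$ which form a $B$-free $B$-valued semicircular system with mean $0$ and variances $\eta_1,\dots,\eta_d$; that is, $S_1,\dots,S_d$ are $B$-freely independent with respect to $E$, and for every $j$, $k$ and $b_0,\dots,b_k\in B$ $$E[b_0S_jb_1S_j\cdots S_jb_k]=\sum_{\pi\in NC_2(k)}b_0\,(\eta_j)_\pi(b_1,\dots,b_{k-1})\,b_k,$$ where $NC_2(k)$ is the set of non-crossing pair partitions of $k$ points and $(\eta_j)_\pi$ is the multiplicative functional determined by $\eta_j$ (for example $\eta_{\{\{1,4\},\{2,3\}\}}(b_1,b_2,b_3)=\eta(b_1\eta(b_2)b_3)$). Let $B_{\langle d\rangle}=B\langle X_1,\dots,X_d\rangle$ be the algebraic free product of $B$ and $\mathbb C\langle X_1,\dots,X_d\rangle$, let $\mathrm{ev}_S:B_{\langle d\rangle}\to A$ be the evaluation homomorphism ($X_j\mapsto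 S_j$, $b\mapsto b$), $B_{\langle d|S\rangle}=\mathrm{ev}_S(B_{\langle d\rangle})$, and let $\partial_j:B_{\langle d\rangle}\to B_{\langle d\rangle}\otimes B_{\langle d\rangle}$ be the free difference quotient, i.e. the derivation with $\partial_j[b]=0$ for $b\in B$ and $\partial_j[X_i]=\delta_{ij}\,1\otimes1$. Put $\langle a,a'\rangle_\tau=\tau(a^*a')$ on $A$ and $\langle a_1\otimes a_2,a_3\otimes a_4\rangle_{\eta_j}=\tau(a_2^*\,\eta_j(E[a_1^*a_3])\,a_4)$ on $A\otimes A$. Let $L^2(B,\tau)\subset L^2(B_{\langle d|S\rangle},\tau)\subset L^2(A,\tau)$ be the completions of $B$, $B_{\langle d|S\rangle}$ and $A$ for $\langle\cdot,\cdot\rangle_\tau$, extend $E$ continuously to $L^2(A,\tau)$, let $L^2(B_{\langle d|S\rangle}^{\otimes2},\tau,\eta_j)$ be the Hilbert space obtained from $B_{\langle d|S\rangle}\otimes B_{\langle d|S\rangle}$ by separation and completion for $\langle\cdot,\cdot\rangle_{\eta_j}$, and let $L^2(B_{\langle d|S\rangle}^{\otimes2},\tau,\eta)=\bigoplus_{j=1}^dL^2(B_{\langle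 d|S\rangle}^{\otimes2},\tau,\eta_j)$, with norm $\|\cdot\|_\eta$. Then the formulas $\partial_{S_j,\eta_j}(P(S))=[(\mathrm{ev}_S\otimes\mathrm{ev}_S)(\partial_jP)]$ and $\partial_{S,\eta}(P(S))=(\partial_{S_j,\eta_j}(P(S)))_{j=1}^d$ for $P\in B_{\langle d\rangle}$ give well-defined closable operators $\partial_{S_j,\eta_j}$ and $\partial_{S,\eta}$ from $L^2(B_{\langle d|S\rangle},\tau)$ to $L^2(B_{\langle d|S\rangle}^{\otimes2},\tau,\eta_j)$ and $L^2(B_{\langle d|S\rangle}^{\otimes2},\tau,\eta)$ respectively, with domain $B_{\langle d|S\rangle}$. Their closures $\overline\partial_{S_j,\eta_j}$ and $\overline\partial_{S,\eta}$ satisfy, for every $\xi\in\mathrm{dom}(\overline\partial_{S,\eta})$: $\xi\in\mathrm{dom}(\overline\partial_{S_j,\eta_j})$ for all $j$, and $$\|\xi-E[\xi]\|_\tau^2\le\sum_{j=1}^d\|\overline\partial_{S_j,\eta_j}\xi\|_{\eta_j}^2=\|\overline\partial_{S,\eta}\xi\|_\eta^2 .$$ Moreover $\ker(\overline\partial_{S,\eta})=L^2(B,\tau)$.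 -/

import Mathlib

open scoped ComplexOrder CStarAlgebra TensorProduct

noncomputable section

namespace OpValued

/-! ### Positive matrices over a C⋆-algebra -/

section Positivity

theorem exists_star_mul_self {D : Type*} [CStarAlgebra D] [PartialOrder D] [StarOrderedRing D]
    (M : D) (hM : 0 ≤ M) : ∃ y : D, M = star y * y :=
  CStarAlgebra.nonneg_iff_eq_star_mul_self.mp hM

theorem exists_compression {D : Type*} [CStarAlgebra D] [PartialOrder D] [StarOrderedRing D]
    (M : D) (hM : IsSelfAdjoint M) :
    ∃ x y : D, star x = x ∧ x * M * x = -(star y * y) ∧ (y = 0 → 0 ≤ M) := by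
  have hx : 0 ≤ M⁻ := CFC.negPart_nonneg M
  obtain ⟨z, hz⟩ := CStarAlgebra.nonneg_iff_eq_star_mul_self.mp hx
  have hxs : star M⁻ = M⁻ := hx.isSelfAdjoint
  refine ⟨M⁻, z * M⁻, hxs, ?_, fun hzx => ?_⟩
  · have h1 : M * M⁻ = -(M⁻ * M⁻) := by
      have h2 : (M⁺ - M⁻) * M⁻ = -(M⁻ * M⁻) := by
        rw [sub_mul, CFC.posPart_mul_negPart, zero_sub]
      rwa [CFC.posPart_sub_negPart M hM] at h2
    rw [mul_assoc, h1, star_mul, hxs, mul_neg, mul_assoc, ← mul_assoc (star z), ← hz]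
  · have hx0 : M⁻ = 0 := by
      apply CStarRing.star_mul_self_eq_zero_iff _ |>.mp
      rw [hxs]
      nth_rw 1 [hz]
      rw [mul_assoc, hzx, mul_zero]
    have := CFC.posPart_sub_negPart M hM
    rw [hx0, sub_zero] at this
    rw [← this]
    exact CFC.posPart_nonneg M

theorem cstarMatrix_nonneg {B : Type*} [CStarAlgebra B] [PartialOrder B]
    [StarOrderedRing B] {n : ℕ} (M : CStarMatrix (Fin n) (Fin n) B) (hM : IsSelfAdjoint M)
    (h : ∀ b : Fin n → B, 0 ≤ ∑ i, ∑ j, star (b i) * M i j * b j) : 0 ≤ M := by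
  obtain ⟨x, y, hxs, hxy, hy⟩ := exists_compression M hM
  refine hy (CStarMatrix.ext fun i k => ?_)
  have hs : ∀ a, x k a = star (x a k) := fun a => by
    conv_lhs => rw [← hxs]
    exact CStarMatrix.star_apply
  have hk : (x * M * x) k k = ∑ i, ∑ j, star (x i k) * M i j * x j k := by
    rw [CStarMatrix.mul_apply, Finset.sum_comm]
    refine Finset.sum_congr rfl fun a _ => ?_
    rw [CStarMatrix.mul_apply, Finset.sum_mul]
    simp only [hs]
  have hpos := h (fun i => x i k)
  have hk2 : (star y * y) k k = ∑ a, star (y a k) * y a k := by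
    rw [CStarMatrix.mul_apply]
    simp only [CStarMatrix.star_apply]
  rw [← hk, hxy, CStarMatrix.neg_apply, hk2] at hpos
  have hnn : ∀ a ∈ Finset.univ, 0 ≤ star (y a k) * y a k :=
    fun a _ => star_mul_self_nonneg _
  have h0 := le_antisymm (neg_nonneg.mp hpos) (Finset.sum_nonneg hnn)
  exact CStarRing.star_mul_self_eq_zero_iff _ |>.mp
    ((Finset.sum_eq_zero_iff_of_nonneg hnn).mp h0 i (Finset.mem_univ i))

theorem sum_nonneg_of_cstarMatrix {A B : Type*} [CStarAlgebra A] [PartialOrder A]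
    [StarOrderedRing A] [CStarAlgebra B] [PartialOrder B]
    [StarOrderedRing B] (f : B →⋆ₐ[ℂ] A) {n : ℕ} (M : CStarMatrix (Fin n) (Fin n) B) (hM : 0 ≤ M)
    (c : Fin n → A) : 0 ≤ ∑ i, ∑ j, star (c i) * f (M i j) * c j := by
  obtain ⟨y, rfl⟩ := exists_star_mul_self M hM
  have : ∑ i, ∑ j, star (c i) * f ((star y * y) i j) * c j
      = ∑ k, star (∑ i, f (y k i) * c i) * ∑ j, f (y k j) * c j := by
    simp only [CStarMatrix.mul_apply, CStarMatrix.star_apply, star_sum, star_mul, map_sum, map_mul,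
      map_star, Finset.sum_mul_sum]
    conv_rhs => rw [Finset.sum_comm]
    refine Finset.sum_congr rfl fun i _ => ?_
    conv_rhs => rw [Finset.sum_comm]
    simp only [mul_assoc, Finset.mul_sum, Finset.sum_mul]
  rw [this]
  exact Finset.sum_nonneg fun k _ => star_mul_self_nonneg _

end Positivity

/-! ### `B`-valued noncommutative polynomials and free difference quotients -/

section Polynomials

/-- The relations which say that `b ↦ b` is a unital algebra homomorphism from `B`. -/
inductive BPolyRel (B : Type*) [Ring B] [Algebra ℂ B] (ι : Type*) :
    FreeAlgebra ℂ (B ⊕ ι) → FreeAlgebra ℂ (B ⊕ ι) → Prop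
  | add (b c : B) : BPolyRel B ι (FreeAlgebra.ι ℂ (Sum.inl (b + c)))
      (FreeAlgebra.ι ℂ (Sum.inl b) + FreeAlgebra.ι ℂ (Sum.inl c))
  | mul (b c : B) : BPolyRel B ι (FreeAlgebra.ι ℂ (Sum.inl (b * c)))
      (FreeAlgebra.ι ℂ (Sum.inl b) * FreeAlgebra.ι ℂ (Sum.inl c))
  | scalar (r : ℂ) : BPolyRel B ι (FreeAlgebra.ι ℂ (Sum.inl (algebraMap ℂ B r)))
      (algebraMap ℂ (FreeAlgebra ℂ (B ⊕ ι)) r)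

/-- `B⟨X_i : i ∈ ι⟩`, the algebraic free product (amalgamated over `ℂ`) of the unital algebra `B`
with the free unital algebra on the letters `X_i`. -/
def BPoly (B : Type*) [Ring B] [Algebra ℂ B] (ι : Type*) := RingQuot (BPolyRel B ι)

namespace BPoly

variable {B : Type*} [Ring B] [Algebra ℂ B] {ι : Type*}

instance : Ring (BPoly B ι) := inferInstanceAs (Ring (RingQuot (BPolyRel B ι)))

instance : Algebra ℂ (BPoly B ι) := inferInstanceAs (Algebra ℂ (RingQuot (BPolyRel B ι)))

/-- The quotient map from the free algebra on the elements of `B` and the letters. -/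
def mk : FreeAlgebra ℂ (B ⊕ ι) →ₐ[ℂ] BPoly B ι := RingQuot.mkAlgHom ℂ (BPolyRel B ι)

theorem mk_eq {x y : FreeAlgebra ℂ (B ⊕ ι)} (h : BPolyRel B ι x y) :
    (mk x : BPoly B ι) = mk y := RingQuot.mkAlgHom_rel ℂ h

/-- The letter `X_i`. -/
def X (i : ι) : BPoly B ι := mk (FreeAlgebra.ι ℂ (Sum.inr i))

/-- The embedding of the coefficient algebra. -/
def C : B →ₐ[ℂ] BPoly B ι where
  toFun b := mk (FreeAlgebra.ι ℂ (Sum.inl b))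
  map_one' := by
    have := mk_eq (BPolyRel.scalar (B := B) (ι := ι) 1)
    rwa [map_one, map_one, map_one] at this
  map_mul' b c := by rw [mk_eq (BPolyRel.mul b c), map_mul]
  map_zero' := by
    have := mk_eq (BPolyRel.scalar (B := B) (ι := ι) 0)
    rwa [map_zero, map_zero, map_zero] at this
  map_add' b c := by rw [mk_eq (BPolyRel.add b c), map_add]
  commutes' r := by rw [mk_eq (BPolyRel.scalar r), AlgHom.commutes]

/-- The universal property: a unital algebra homomorphism on `B` and a choice of values for the
letters extend to a unital algebra homomorphism on `B⟨X⟩`. -/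
def lift {R : Type*} [Ring R] [Algebra ℂ R] (f : B →ₐ[ℂ] R) (x : ι → R) : BPoly B ι →ₐ[ℂ] R :=
  RingQuot.liftAlgHom ℂ ⟨FreeAlgebra.lift ℂ (Sum.elim f x), by
    intro a b h
    cases h <;> simp⟩

@[simp] theorem lift_C {R : Type*} [Ring R] [Algebra ℂ R] (f : B →ₐ[ℂ] R) (x : ι → R) (b : B) :
    lift f x (C b) = f b := by
  refine (RingQuot.liftAlgHom_mkAlgHom_apply _ _ _ _).trans ?_
  simp

@[simp] theorem lift_X {R : Type*} [Ring R] [Algebra ℂ R] (f : B →ₐ[ℂ] R) (x : ι → R) (i : ι) :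
    lift f x (X i) = x i := by
  refine (RingQuot.liftAlgHom_mkAlgHom_apply _ _ _ _).trans ?_
  simp

theorem algHom_ext {R : Type*} [Ring R] [Algebra ℂ R] {f g : BPoly B ι →ₐ[ℂ] R}
    (hC : ∀ b, f (C b) = g (C b)) (hX : ∀ i, f (X i) = g (X i)) : f = g := by
  refine RingQuot.ringQuot_ext' ℂ f g (FreeAlgebra.hom_ext (funext fun s => ?_))
  cases s with
  | inl b => exact hC b
  | inr i => exact hX i

theorem induction {p : BPoly B ι → Prop} (hC : ∀ b, p (C b)) (hX : ∀ i, p (X i))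
    (hadd : ∀ P Q, p P → p Q → p (P + Q)) (hmul : ∀ P Q, p P → p Q → p (P * Q))
    (P : BPoly B ι) : p P := by
  obtain ⟨P, rfl⟩ := RingQuot.mkAlgHom_surjective ℂ (BPolyRel B ι) P
  change p (mk P)
  induction P using FreeAlgebra.induction with
  | grade0 r =>
    have := hC (algebraMap ℂ B r)
    rwa [AlgHom.commutes, ← AlgHom.commutes mk] at this
  | grade1 s =>
    cases s with
    | inl b => exact hC b
    | inr i => exact hX i
  | mul P Q hP hQ => rw [map_mul]; exact hmul _ _ hP hQ
  | add P Q hP hQ => rw [map_add]; exact hadd _ _ hP hQ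

variable [DecidableEq ι]

/-- The homomorphism `P ↦ [[P ⊗ 1, ∂_j P], [0, 1 ⊗ P]]`: its multiplicativity is the Leibniz rule
of `∂_j`. -/
def fdqMatrix (j : ι) :
    BPoly B ι →ₐ[ℂ] Matrix (Fin 2) (Fin 2) (BPoly B ι ⊗[ℂ] BPoly B ι) :=
  lift
    { toFun := fun b => !![C b ⊗ₜ 1, 0; 0, 1 ⊗ₜ C b]
      map_one' := by
        ext i k; fin_cases i <;> fin_cases k <;> simp [Algebra.TensorProduct.one_def]
      map_mul' := fun b c => by
        ext i k; fin_cases i <;> fin_cases k <;> simp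
      map_zero' := by
        ext i k; fin_cases i <;> fin_cases k <;> simp
      map_add' := fun b c => by
        ext i k; fin_cases i <;> fin_cases k <;> simp [TensorProduct.add_tmul, TensorProduct.tmul_add]
      commutes' := fun r => by
        ext i k; fin_cases i <;> fin_cases k <;>
          simp [Matrix.algebraMap_matrix_apply, Algebra.algebraMap_eq_smul_one,
            Algebra.TensorProduct.one_def, TensorProduct.smul_tmul'] }
    (fun i => !![X i ⊗ₜ 1, if i = j then 1 else 0; 0, 1 ⊗ₜ X i])

/-- The free difference quotient `∂_j : B⟨X⟩ → B⟨X⟩ ⊗ B⟨X⟩` with respect to `X_j`. -/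
def fdq (j : ι) : BPoly B ι →ₗ[ℂ] BPoly B ι ⊗[ℂ] BPoly B ι where
  toFun P := fdqMatrix j P 0 1
  map_add' P Q := by simp
  map_smul' r P := by simp

theorem fdqMatrix_apply (j : ι) (P : BPoly B ι) :
    fdqMatrix j P = !![P ⊗ₜ 1, fdq j P; 0, 1 ⊗ₜ P] := by
  have h : fdqMatrix j P 0 0 = P ⊗ₜ 1 ∧ fdqMatrix j P 1 0 = 0 ∧ fdqMatrix j P 1 1 = 1 ⊗ₜ P := by
    induction P using BPoly.induction with
    | hC b => simp [fdqMatrix]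
    | hX i => simp [fdqMatrix]
    | hadd P Q hP hQ =>
      simp [hP, hQ, TensorProduct.add_tmul, TensorProduct.tmul_add]
    | hmul P Q hP hQ =>
      simp [Matrix.mul_apply, hP, hQ]
  ext i k; fin_cases i <;> fin_cases k
  · exact h.1
  · rfl
  · exact h.2.1
  · exact h.2.2

@[simp] theorem fdq_C (j : ι) (b : B) : fdq j (C b : BPoly B ι) = 0 := by
  simp [fdq, fdqMatrix]

@[simp] theorem fdq_X (j i : ι) :
    fdq j (X i : BPoly B ι) = if i = j then 1 ⊗ₜ 1 else 0 := by
  simp [fdq, fdqMatrix, Algebra.TensorProduct.one_def]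

/-- The Leibniz rule. -/
theorem fdq_mul (j : ι) (P Q : BPoly B ι) :
    fdq j (P * Q) = (P ⊗ₜ 1) * fdq j Q + fdq j P * (1 ⊗ₜ Q) := by
  have h : fdq j (P * Q) = fdqMatrix j (P * Q) 0 1 := rfl
  rw [h, map_mul, fdqMatrix_apply, fdqMatrix_apply]
  simp [Matrix.mul_apply]

end BPoly

end Polynomials

/-! ### Non-crossing pair partitions -/

section Pairings

/-- `NC₂(k)`: the non-crossing pair partitions of the `k` points `0, …, k - 1`. A pair partition is
given as the set of its blocks, and the block `{i, j}` with `i < j` as the pair `(i, j)`. -/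
def NC2 (k : ℕ) : Finset (Finset (ℕ × ℕ)) :=
  ((Finset.range k ×ˢ Finset.range k).filter fun p => p.1 < p.2).powerset.filter fun π =>
    (∀ i ∈ Finset.range k, (π.filter fun p => p.1 = i ∨ p.2 = i).card = 1) ∧
      ∀ p ∈ π, ∀ q ∈ π, ¬(p.1 < q.1 ∧ q.1 < p.2 ∧ p.2 < q.2)

/-- The multiplicative functional `b_s η_π(b_{s+1}, …, b_{s+n-1}) b_{s+n}` determined by `η` and the
blocks of `π` on the points `s, …, s + n - 1`, where the point `i` stands between `b_i` and
`b_{i+1}`. If the first point `s` is paired with `s + 1 + j`, then `η` is applied to the value of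
the word strictly inside this block, and the result is multiplied by `b_s` from the left and by the
value of the rest of the word from the right. -/
def multFunctional {B : Type*} [Ring B] (η : B → B) (π : Finset (ℕ × ℕ)) (b : ℕ → B) :
    (n s : ℕ) → B
  | 0, s => b s
  | n + 1, s => ∑ j : Fin n, if (s, s + 1 + j) ∈ π then
      b s * η (multFunctional η π b j (s + 1)) * multFunctional η π b (n - 1 - j) (s + 2 + j)
      else 0
  termination_by n => n
  decreasing_by all_goals omega

end Pairings

/-! ### Tracial `B`-valued C⋆-probability spaces -/

/-- A tracial `B`-valued C⋆-probability space `(A, B, τ, E)`: a unital inclusion `B ⊆ A` of unital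
C⋆-algebras, given as an injective unital `*`-homomorphism, a faithful tracial state `τ` on `A`, and
a `τ`-preserving conditional expectation `E` from `A` onto `B`. -/
structure TracialSpace (A B : Type*) [CStarAlgebra A] [PartialOrder A] [StarOrderedRing A]
    [CStarAlgebra B] [PartialOrder B] [StarOrderedRing B] where
  incl : B →⋆ₐ[ℂ] A
  incl_injective : Function.Injective incl
  τ : A →ₚ[ℂ] ℂ
  τ_one : τ 1 = 1
  τ_comm : ∀ a a' : A, τ (a * a') = τ (a' * a)
  τ_faithful : ∀ a : A, τ (star a * a) = 0 → a = 0
  E : A →ₚ[ℂ] B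
  E_incl : ∀ b : B, E (incl b) = b
  E_bimodule : ∀ (b : B) (a : A) (b' : B), E (incl b * a * incl b') = b * E a * b'
  τ_E : ∀ a : A, τ (incl (E a)) = τ a

namespace TracialSpace

variable {A B : Type*} [CStarAlgebra A] [PartialOrder A] [StarOrderedRing A]
  [CStarAlgebra B] [PartialOrder B] [StarOrderedRing B] (𝔄 : TracialSpace A B)

/-! ### Evaluation, freeness, semicircular systems -/

/-- The evaluation homomorphism `ev_Y : B⟨X_i : i ∈ ι⟩ → A`, `X_i ↦ Y_i`. -/
def ev {ι : Type*} (Y : ι → A) : BPoly B ι →ₐ[ℂ] A := BPoly.lift 𝔄.incl.toAlgHom Y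

/-- `B`-freeness of a family `a_1, …, a_d`. The index `n + 1` is the number of factors. -/
def IsFree {d : ℕ} (a : Fin d → A) : Prop :=
  ∀ (n : ℕ) (P : Fin (n + 1) → BPoly B Unit) (i : Fin (n + 1) → Fin d),
    (∀ m : Fin n, i m.castSucc ≠ i m.succ) →
    𝔄.E (List.ofFn fun m =>
      𝔄.ev (fun _ => a (i m)) (P m) - 𝔄.incl (𝔄.E (𝔄.ev (fun _ => a (i m)) (P m)))).prod = 0

/-- The word `b_0 s b_1 s b_2 ⋯ s b_k`. -/
def word (s : A) (b : ℕ → B) : ℕ → A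
  | 0 => 𝔄.incl (b 0)
  | k + 1 => word s b k * s * 𝔄.incl (b (k + 1))

/-- `s` is a `B`-valued semicircular element with mean `0` and variance `η`. -/
def IsSemicircular (η : B →CP B) (s : A) : Prop :=
  IsSelfAdjoint s ∧ ∀ (k : ℕ) (b : ℕ → B),
    𝔄.E (𝔄.word s b k) = ∑ π ∈ NC2 k, multFunctional η π b k 0

/-- `S_1, …, S_d` is a `B`-free `B`-valued semicircular system with variances `η_1, …, η_d`. -/
def IsFreeSemicircularSystem {d : ℕ} (η : Fin d → B →CP B) (S : Fin d → A) : Prop :=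
  𝔄.IsFree S ∧ ∀ j, 𝔄.IsSemicircular (η j) (S j)

/-! ### The Hilbert space `L²(A, τ)` -/

/-- `L²(A, τ)`, the completion of `A` for `⟨a, a'⟩_τ = τ(a* a')`. -/
abbrev L2 : Type _ := 𝔄.τ.GNS

/-- The canonical map `A → L²(A, τ)`. -/
def toL2 : A →ₗ[ℂ] 𝔄.L2 :=
  (UniformSpace.Completion.toComplL (𝕜 := ℂ) (E := 𝔄.τ.PreGNS)).toLinearMap ∘ₗ
    𝔄.τ.toPreGNS.toLinearMap

/-- `L²(B, τ)`, as a closed subspace of `L²(A, τ)`. -/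
def L2B : Submodule ℂ 𝔄.L2 :=
  (LinearMap.range (𝔄.toL2 ∘ₗ 𝔄.incl.toAlgHom.toLinearMap)).topologicalClosure

theorem star_E_mul_le (a : A) : star (𝔄.E a) * 𝔄.E a ≤ 𝔄.E (star a * a) := by
  have h : 0 ≤ 𝔄.E (star (a - 𝔄.incl (𝔄.E a)) * (a - 𝔄.incl (𝔄.E a))) :=
    map_nonneg 𝔄.E (star_mul_self_nonneg _)
  have h1 := 𝔄.E_bimodule 1 (star a) (𝔄.E a)
  have h2 := 𝔄.E_bimodule (star (𝔄.E a)) a 1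
  have h3 := 𝔄.E_incl (star (𝔄.E a) * 𝔄.E a)
  simp only [map_one, one_mul, mul_one, map_mul, map_star] at h1 h2 h3
  simp only [star_sub, sub_mul, mul_sub, map_sub, ← map_star 𝔄.incl] at h
  simp only [map_star] at h
  rw [h1, h2, h3, sub_self, sub_zero, sub_nonneg] at h
  exact h

/-- `E` as a contraction for the norm `‖·‖_τ`. -/
def preCondExp : 𝔄.τ.PreGNS →L[ℂ] 𝔄.τ.PreGNS :=
  LinearMap.mkContinuous
    (𝔄.τ.toPreGNS.toLinearMap ∘ₗ 𝔄.incl.toAlgHom.toLinearMap ∘ₗ 𝔄.E.toLinearMap ∘ₗ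
      𝔄.τ.ofPreGNS.toLinearMap) 1 fun a => by
    rw [one_mul, ← sq_le_sq₀ (norm_nonneg _) (norm_nonneg _), ← Complex.real_le_real]
    push_cast
    rw [PositiveLinearMap.preGNS_norm_sq, PositiveLinearMap.preGNS_norm_sq]
    set x : A := 𝔄.τ.ofPreGNS a
    change 𝔄.τ (star (𝔄.incl (𝔄.E x)) * 𝔄.incl (𝔄.E x)) ≤ 𝔄.τ (star x * x)
    rw [← map_star, ← map_mul, ← 𝔄.τ_E (star x * x)]
    exact OrderHomClass.mono 𝔄.τ (OrderHomClass.mono 𝔄.incl (𝔄.star_E_mul_le x))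

/-- The continuous extension of `E` to `L²(A, τ)`, again written `E`. -/
def condExp : 𝔄.L2 →L[ℂ] 𝔄.L2 := 𝔄.preCondExp.completion

theorem condExp_toL2 (a : A) : 𝔄.condExp (𝔄.toL2 a) = 𝔄.toL2 (𝔄.incl (𝔄.E a)) :=
  ContinuousLinearMap.completion_apply_coe _ _

/-! ### The inner product `⟨·,·⟩_η` on `A ⊗ A` -/

section Eta

variable (η : B →CP B)

/-- The bilinear form `(a₁ ⊗ a₂, a₃ ⊗ a₄) ↦ τ(a₂ η(E[a₁ a₃]) a₄)`. -/
def etaBilin : A ⊗[ℂ] A →ₗ[ℂ] A ⊗[ℂ] A →ₗ[ℂ] ℂ :=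
  TensorProduct.lift (LinearMap.mk₂ ℂ
    (fun a₁ a₂ => TensorProduct.lift (LinearMap.mk₂ ℂ
      (fun a₃ a₄ => 𝔄.τ (a₂ * 𝔄.incl (η (𝔄.E (a₁ * a₃))) * a₄))
      (by intros; simp [mul_add, add_mul]) (by intros; simp)
      (by intros; simp [mul_add]) (by intros; simp)))
    (by intros; ext; simp [mul_add, add_mul]) (by intros; ext; simp)
    (by intros; ext; simp [add_mul]) (by intros; ext; simp))

/-- The form `⟨a₁ ⊗ a₂, a₃ ⊗ a₄⟩_η = τ(a₂* η(E[a₁* a₃]) a₄)`, conjugate linear in the first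
variable. -/
def etaInner (x y : A ⊗[ℂ] A) : ℂ := 𝔄.etaBilin η (star x) y

theorem etaInner_tmul (a₁ a₂ a₃ a₄ : A) :
    𝔄.etaInner η (a₁ ⊗ₜ a₂) (a₃ ⊗ₜ a₄)
      = 𝔄.τ (star a₂ * 𝔄.incl (η (𝔄.E (star a₁ * a₃))) * a₄) := by
  simp [etaInner, etaBilin, TensorProduct.star_tmul]

theorem etaInner_conj (x y : A ⊗[ℂ] A) :
    (starRingEnd ℂ) (𝔄.etaInner η y x) = 𝔄.etaInner η x y := by
  induction x using TensorProduct.induction_on with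
  | zero => simp [etaInner]
  | add x x' hx hx' =>
    have : 𝔄.etaInner η (x + x') y = 𝔄.etaInner η x y + 𝔄.etaInner η x' y := by
      simp [etaInner, star_add]
    rw [this, ← hx, ← hx']
    simp [etaInner]
  | tmul a₁ a₂ =>
    induction y using TensorProduct.induction_on with
    | zero => simp [etaInner]
    | add y y' hy hy' =>
      have : 𝔄.etaInner η (y + y') (a₁ ⊗ₜ a₂)
          = 𝔄.etaInner η y (a₁ ⊗ₜ a₂) + 𝔄.etaInner η y' (a₁ ⊗ₜ a₂) := by
        simp [etaInner, star_add]
      rw [this, map_add, hy, hy']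
      simp [etaInner]
    | tmul a₃ a₄ =>
      rw [etaInner_tmul, etaInner_tmul, starRingEnd_apply, ← map_star 𝔄.τ]
      simp only [star_mul, star_star, ← map_star, mul_assoc]

theorem etaInner_self_nonneg (x : A ⊗[ℂ] A) : 0 ≤ 𝔄.etaInner η x x := by
  obtain ⟨n, a, c, rfl⟩ : ∃ (n : ℕ) (a c : Fin n → A), x = ∑ i, a i ⊗ₜ[ℂ] c i := by
    induction x using TensorProduct.induction_on with
    | zero => exact ⟨0, Fin.elim0, Fin.elim0, by simp⟩
    | tmul a c => exact ⟨1, fun _ => a, fun _ => c, by simp⟩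
    | add x y hx hy =>
      obtain ⟨n, a, c, rfl⟩ := hx
      obtain ⟨m, a', c', rfl⟩ := hy
      exact ⟨n + m, Fin.append a a', Fin.append c c', by simp [Fin.sum_univ_add]⟩
  let M : CStarMatrix (Fin n) (Fin n) B := CStarMatrix.ofMatrix fun i j => 𝔄.E (star (a i) * a j)
  have hMij : ∀ i j, M i j = 𝔄.E (star (a i) * a j) := fun _ _ => rfl
  have hM : 0 ≤ M := by
    refine cstarMatrix_nonneg M ?_ fun b => ?_
    · refine CStarMatrix.ext fun i j => ?_
      rw [CStarMatrix.star_apply, hMij, hMij, ← map_star, star_mul, star_star]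
    · have h : ∑ i, ∑ j, star (b i) * M i j * b j
          = 𝔄.E (star (∑ i, a i * 𝔄.incl (b i)) * ∑ j, a j * 𝔄.incl (b j)) := by
        rw [star_sum, Finset.sum_mul_sum, map_sum]
        refine Finset.sum_congr rfl fun i _ => ?_
        rw [map_sum]
        refine Finset.sum_congr rfl fun j _ => ?_
        rw [hMij, ← 𝔄.E_bimodule, star_mul, map_star]
        simp only [mul_assoc]
      rw [h]
      exact map_nonneg 𝔄.E (star_mul_self_nonneg _)
  have hη : 0 ≤ M.map η := CompletelyPositiveMap.map_cstarMatrix_nonneg η M hM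
  have h : 𝔄.etaInner η (∑ i, a i ⊗ₜ[ℂ] c i) (∑ i, a i ⊗ₜ[ℂ] c i)
      = 𝔄.τ (∑ i, ∑ j, star (c i) * 𝔄.incl ((M.map η) i j) * c j) := by
    have h1 : ∀ y, 𝔄.etaInner η (∑ i, a i ⊗ₜ[ℂ] c i) y
        = ∑ i, 𝔄.etaInner η (a i ⊗ₜ[ℂ] c i) y := fun y => by
      simp [etaInner, star_sum]
    have h2 : ∀ x, 𝔄.etaInner η x (∑ i, a i ⊗ₜ[ℂ] c i)
        = ∑ i, 𝔄.etaInner η x (a i ⊗ₜ[ℂ] c i) := fun x => by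
      simp [etaInner]
    simp only [h1, h2, map_sum, etaInner_tmul]
    rfl
  rw [h]
  exact map_nonneg 𝔄.τ (sum_nonneg_of_cstarMatrix 𝔄.incl _ hη c)

set_option linter.unusedVariables false in
/-- The algebraic tensor product `A ⊗ A` with the semi-norm `‖·‖_η`. -/
@[nolint unusedArguments]
def EtaTensor (𝔄 : TracialSpace A B) (η : B →CP B) : Type _ := A ⊗[ℂ] A

instance : AddCommGroup (𝔄.EtaTensor η) := inferInstanceAs (AddCommGroup (A ⊗[ℂ] A))

instance : Module ℂ (𝔄.EtaTensor η) := inferInstanceAs (Module ℂ (A ⊗[ℂ] A))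

/-- The identity map from `A ⊗ A` to `A ⊗ A` with the semi-norm `‖·‖_η`. -/
def toEtaTensor : A ⊗[ℂ] A ≃ₗ[ℂ] 𝔄.EtaTensor η := LinearEquiv.refl ℂ _

/-- The pre-inner product `⟨·,·⟩_η`. -/
abbrev etaCore : PreInnerProductSpace.Core ℂ (𝔄.EtaTensor η) where
  inner x y := 𝔄.etaInner η ((𝔄.toEtaTensor η).symm x) ((𝔄.toEtaTensor η).symm y)
  conj_inner_symm x y := 𝔄.etaInner_conj η _ _
  re_inner_nonneg x := (RCLike.nonneg_iff.mp (𝔄.etaInner_self_nonneg η _)).1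
  add_left x y z := by simp [etaInner, star_add]
  smul_left x y r := by simp [etaInner, star_smul]

instance : SeminormedAddCommGroup (𝔄.EtaTensor η) :=
  InnerProductSpace.Core.toSeminormedAddCommGroup (c := 𝔄.etaCore η)

instance : InnerProductSpace ℂ (𝔄.EtaTensor η) :=
  InnerProductSpace.ofCore (𝔄.etaCore η)

/-- The Hilbert space obtained from `A ⊗ A` and `⟨·,·⟩_η` by separation and completion. -/
abbrev L2Eta : Type _ := UniformSpace.Completion (𝔄.EtaTensor η)

/-- The canonical map from `A ⊗ A` to its separation and completion. -/
def toL2Eta : A ⊗[ℂ] A →ₗ[ℂ] 𝔄.L2Eta η :=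
  (UniformSpace.Completion.toComplL (𝕜 := ℂ) (E := 𝔄.EtaTensor η)).toLinearMap ∘ₗ
    (𝔄.toEtaTensor η).toLinearMap

theorem inner_toL2Eta (x y : A ⊗[ℂ] A) :
    inner ℂ (𝔄.toL2Eta η x) (𝔄.toL2Eta η y) = 𝔄.etaInner η x y :=
  UniformSpace.Completion.inner_coe _ _

end Eta

/-! ### The free difference quotients as unbounded operators -/

section Operators

variable {d : ℕ} (η : Fin d → B →CP B) (S : Fin d → A)

/-- `ev_S ⊗ ev_S`. -/
def evTensor : BPoly B (Fin d) ⊗[ℂ] BPoly B (Fin d) →ₗ[ℂ] A ⊗[ℂ] A :=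
  TensorProduct.map (𝔄.ev S).toLinearMap (𝔄.ev S).toLinearMap

/-- `L²(B⟨d|S⟩, τ)`, the closure of `B⟨d|S⟩ = ev_S(B⟨d⟩)` in `L²(A, τ)`. -/
def L2Poly : Submodule ℂ 𝔄.L2 :=
  (LinearMap.range (𝔄.toL2 ∘ₗ (𝔄.ev S).toLinearMap)).topologicalClosure

/-- `L²(B⟨d|S⟩ ⊗ B⟨d|S⟩, τ, η_j)`, the closure of the image of `B⟨d|S⟩ ⊗ B⟨d|S⟩`. -/
def L2PolyTensor (j : Fin d) : Submodule ℂ (𝔄.L2Eta (η j)) :=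
  (LinearMap.range (𝔄.toL2Eta (η j) ∘ₗ 𝔄.evTensor S)).topologicalClosure

/-- The orthogonal sum `L²(B⟨d|S⟩ ⊗ B⟨d|S⟩, τ, η) = ⊕_j L²(B⟨d|S⟩ ⊗ B⟨d|S⟩, τ, η_j)`. -/
abbrev L2PolyTensorSum : Type _ := PiLp 2 fun j => 𝔄.L2PolyTensor η S j

/-- `P ↦ P(S)`, with values in `L²(B⟨d|S⟩, τ)`. -/
def evL2 : BPoly B (Fin d) →ₗ[ℂ] 𝔄.L2Poly S :=
  (𝔄.toL2 ∘ₗ (𝔄.ev S).toLinearMap).codRestrict (𝔄.L2Poly S) fun P =>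
    Submodule.le_topologicalClosure _ ⟨P, rfl⟩

/-- `P ↦ (ev_S ⊗ ev_S)(∂_j P)`, with values in `L²(B⟨d|S⟩ ⊗ B⟨d|S⟩, τ, η_j)`. -/
def fdqL2 (j : Fin d) : BPoly B (Fin d) →ₗ[ℂ] 𝔄.L2PolyTensor η S j :=
  (𝔄.toL2Eta (η j) ∘ₗ 𝔄.evTensor S ∘ₗ BPoly.fdq j).codRestrict _ fun P =>
    Submodule.le_topologicalClosure _ ⟨BPoly.fdq j P, rfl⟩

/-- `P ↦ ((ev_S ⊗ ev_S)(∂_j P))_j`. -/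
def gradL2 : BPoly B (Fin d) →ₗ[ℂ] 𝔄.L2PolyTensorSum η S :=
  (WithLp.linearEquiv 2 ℂ (∀ j, 𝔄.L2PolyTensor η S j)).symm.toLinearMap ∘ₗ
    LinearMap.pi (𝔄.fdqL2 η S)

/-- The operator `∂_{S_j,η_j}` with domain `B⟨d|S⟩`, whose graph consists of the pairs
`(P(S), (ev_S ⊗ ev_S)(∂_j P))`. -/
def partialOp (j : Fin d) : 𝔄.L2Poly S →ₗ.[ℂ] 𝔄.L2PolyTensor η S j :=
  (LinearMap.range ((𝔄.evL2 S).prod (𝔄.fdqL2 η S j))).toLinearPMap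

/-- The operator `∂_{S,η} = (∂_{S_1,η_1}, …, ∂_{S_d,η_d})` with domain `B⟨d|S⟩`, whose graph consists
of the pairs `(P(S), ((ev_S ⊗ ev_S)(∂_j P))_j)`. -/
def gradOp : 𝔄.L2Poly S →ₗ.[ℂ] 𝔄.L2PolyTensorSum η S :=
  (LinearMap.range ((𝔄.evL2 S).prod (𝔄.gradL2 η S))).toLinearPMap

end Operators

end TracialSpace

end OpValued

end

open scoped ComplexOrder CStarAlgebra TensorProduct

noncomputable section

namespace OpValued

/-! ### Non-crossing pairings and the recursion for semicircular moments -/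

section PairingSums

/-! The space L²(B⟨d|S⟩, τ) behaves like a full Fock space over `B`. Its analogue of elementary
tensors are the Wick words `BPoly.wick`: they span B⟨d⟩, words of different lengths are orthogonal,
and `E` kills those of positive length, so that `E` is the projection onto degree zero.

On this grading ∂_j^*∂_j counts the letters `j` (`etaInner_fdq_wick`). Indeed ∂_j cuts a Wick word
at each letter `j` into a tensor of two Wick words (`fdq_wick`); for two words, cuts at different
positions are orthogonal, and each pair of matching cuts returns the inner product of the uncut
words (`sum_wickInner`). Summing over `j` gives the number operator, which is at least 1 off degree
zero: this is the Poincaré inequality for polynomials (`norm_sq_le_of_graded`), and it survives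
passage to the closed graph. The same identity writes every ⟨∂Q, ∂P⟩ as some ⟨Q'(S), P(S)⟩. Hence
the closed graph contains no nonzero vertical vector (`eq_zero_of_mem_closure_graph`), which is
well-definedness and closability at once. A vector with zero gradient equals its expectation by the
inequality, and limits of elements of `B` have zero gradient; this identifies the kernel.

The inner products of Wick words rest on the Schwinger–Dyson equation E[S_j P(S)] = E[(η_j E ⊗
id)(∂_j P)]. For one letter it is the recursion of NC₂ on the block of the first point; freeness
extends it to several letters. Traciality then upgrades it to the statement that S_j is the sum of
an annihilation operator and its adjoint (`E_star_mul`), and induction on the word length gives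
`wickInner`. -/

theorem mem_NC2 {k : ℕ} {π : Finset (ℕ × ℕ)} :
    π ∈ NC2 k ↔ (∀ a c, (a, c) ∈ π → a < c ∧ c < k) ∧
      (∀ i < k, ∃ a, (a, i) ∈ π ∨ (i, a) ∈ π) ∧
      (∀ a c a' c', (a, c) ∈ π → (a', c') ∈ π →
        a = a' ∨ c = c' ∨ a = c' → a = a' ∧ c = c') ∧
      ∀ a c a' c', (a, c) ∈ π → (a', c') ∈ π → ¬(a < a' ∧ a' < c ∧ c < c') := by
  simp only [NC2, Finset.mem_filter, Finset.mem_powerset, Finset.mem_range]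
  constructor
  · rintro ⟨h1, h2, h3⟩
    have hs : ∀ a c, (a, c) ∈ π → a < c ∧ c < k := fun a c h => by
      have := h1 h
      simp at this
      omega
    refine ⟨hs, fun i hi => ?_, fun a c a' c' h h' hh => ?_, fun a c a' c' h h' => h3 _ h _ h'⟩
    · obtain ⟨⟨a, c⟩, hp⟩ := Finset.card_eq_one.mp (h2 i hi)
      have : (a, c) ∈ π.filter fun p => p.1 = i ∨ p.2 = i := by rw [hp]; simp
      simp only [Finset.mem_filter] at this
      rcases this.2 with rfl | rfl
      · exact ⟨c, Or.inr this.1⟩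
      · exact ⟨a, Or.inl this.1⟩
    · have key : ∀ i, i < k → (a = i ∨ c = i) → (a' = i ∨ c' = i) → (a, c) = (a', c') := by
        intro i hi hu hv
        refine Finset.card_le_one.mp (h2 i hi).le _ ?_ _ ?_ <;> simp [*]
      have l := hs a c h
      have l' := hs a' c' h'
      rcases hh with rfl | rfl | rfl
      · simpa using key a (by omega) (by simp) (by simp)
      · simpa using key c (by omega) (by simp) (by simp)
      · simpa using key a (by omega) (by simp) (by simp)
  · rintro ⟨hs, he, hu, hn⟩
    refine ⟨fun p hp => ?_, fun i hi => ?_, fun p hp q hq => hn _ _ _ _ hp hq⟩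
    · have := hs p.1 p.2 hp
      simp
      omega
    · rw [Finset.card_eq_one]
      obtain ⟨a, h | h⟩ := he i hi
      · refine ⟨(a, i), ?_⟩
        ext ⟨x, y⟩
        simp only [Finset.mem_filter, Finset.mem_singleton, Prod.mk.injEq]
        constructor
        · rintro ⟨h', hh⟩
          rcases hh with rfl | rfl
          · have := hu _ _ _ _ h' h (by simp); omega
          · have := hu _ _ _ _ h' h (by simp); omega
        · rintro ⟨rfl, rfl⟩; simp [h]
      · refine ⟨(i, a), ?_⟩
        ext ⟨x, y⟩
        simp only [Finset.mem_filter, Finset.mem_singleton, Prod.mk.injEq]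
        constructor
        · rintro ⟨h', hh⟩
          rcases hh with rfl | rfl
          · have := hu _ _ _ _ h' h (by simp); omega
          · have := hu _ _ _ _ h h' (by simp); omega
        · rintro ⟨rfl, rfl⟩; simp [h]

/-- The recursion only inspects pairs and coefficients inside the window starting at `s`, so it is
local and translation invariant. This lets the inner and right parts of a pairing be treated as
pairings starting at 0. -/
theorem multFunctional_congr {B : Type*} [Ring B] (η : B → B) {π π' : Finset (ℕ × ℕ)}
    {b b' : ℕ → B} : ∀ (n s s' : ℕ),
    (∀ a < n, ∀ c < n, ((s + a, s + c) ∈ π ↔ (s' + a, s' + c) ∈ π')) →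
    (∀ a ≤ n, b (s + a) = b' (s' + a)) →
    multFunctional η π b n s = multFunctional η π' b' n s' := by
  intro n
  induction n using Nat.strong_induction_on with
  | _ n ih =>
    intro s s' hπ hb
    cases n with
    | zero =>
      rw [multFunctional, multFunctional]
      simpa using hb 0 le_rfl
    | succ n =>
      rw [multFunctional, multFunctional]
      refine Finset.sum_congr rfl fun j _ => ?_
      have hj := j.2
      have h0 := hπ 0 (by omega) (1 + j) (by omega)
      simp only [add_zero, ← add_assoc] at h0
      have hb0 := hb 0 (by omega)
      simp only [add_zero] at hb0
      rw [hb0, ih j (by omega) (s + 1) (s' + 1), ih (n - 1 - j) (by omega) (s + 2 + j) (s' + 2 + j)]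
      · simp only [h0]
      · intro a ha c hc
        have := hπ (2 + j + a) (by omega) (2 + j + c) (by omega)
        simpa only [← add_assoc] using this
      · intro a ha
        have := hb (2 + j + a) (by omega)
        simpa only [← add_assoc] using this
      · intro a ha c hc
        have := hπ (1 + a) (by omega) (1 + c) (by omega)
        simpa only [← add_assoc] using this
      · intro a ha
        have := hb (1 + a) (by omega)
        simpa only [← add_assoc] using this

/-- The pairs of `π` inside the interval `s, …, s + n - 1`, shifted to `0, …, n - 1`. -/
def restrictPairing (π : Finset (ℕ × ℕ)) (s n : ℕ) : Finset (ℕ × ℕ) :=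
  (Finset.range n ×ˢ Finset.range n).filter fun p => (s + p.1, s + p.2) ∈ π

theorem mem_restrictPairing {π : Finset (ℕ × ℕ)} {s n a c : ℕ} :
    (a, c) ∈ restrictPairing π s n ↔ (a < n ∧ c < n) ∧ (s + a, s + c) ∈ π := by
  simp [restrictPairing]

/-- The pairing of `k + 1` points with block `(0, 1 + j)`, which is `π₁` inside this block and `π₂`
to the right of it. -/
def gluePairing (k j : ℕ) (π₁ π₂ : Finset (ℕ × ℕ)) : Finset (ℕ × ℕ) :=
  (Finset.range (k + 1) ×ˢ Finset.range (k + 1)).filter fun p => p = (0, 1 + j) ∨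
    (1 ≤ p.1 ∧ 1 ≤ p.2 ∧ (p.1 - 1, p.2 - 1) ∈ π₁) ∨
    (2 + j ≤ p.1 ∧ 2 + j ≤ p.2 ∧ (p.1 - (2 + j), p.2 - (2 + j)) ∈ π₂)

theorem mem_gluePairing {k j : ℕ} (hj : j < k) {π₁ π₂ : Finset (ℕ × ℕ)} (h₁ : π₁ ∈ NC2 j)
    (h₂ : π₂ ∈ NC2 (k - 1 - j)) {a c : ℕ} :
    (a, c) ∈ gluePairing k j π₁ π₂ ↔ (a = 0 ∧ c = 1 + j) ∨
      (∃ a' c', a = 1 + a' ∧ c = 1 + c' ∧ (a', c') ∈ π₁) ∨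
      (∃ a' c', a = 2 + j + a' ∧ c = 2 + j + c' ∧ (a', c') ∈ π₂) := by
  simp only [gluePairing, Finset.mem_filter, Finset.mem_product, Finset.mem_range, Prod.mk.injEq]
  constructor
  · rintro ⟨_, h | ⟨ha, hc, h⟩ | ⟨ha, hc, h⟩⟩
    · exact Or.inl h
    · exact Or.inr (Or.inl ⟨_, _, by omega, by omega, h⟩)
    · exact Or.inr (Or.inr ⟨_, _, by omega, by omega, h⟩)
  · rintro (⟨rfl, rfl⟩ | ⟨a', c', rfl, rfl, h⟩ | ⟨a', c', rfl, rfl, h⟩)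
    · exact ⟨by omega, by simp⟩
    · have := (mem_NC2.mp h₁).1 _ _ h
      exact ⟨by omega, Or.inr (Or.inl (by simpa using h))⟩
    · have := (mem_NC2.mp h₂).1 _ _ h
      exact ⟨by omega, Or.inr (Or.inr (by simpa using h))⟩

theorem gluePairing_mem {k j : ℕ} (hj : j < k) {π₁ π₂ : Finset (ℕ × ℕ)} (h₁ : π₁ ∈ NC2 j)
    (h₂ : π₂ ∈ NC2 (k - 1 - j)) : gluePairing k j π₁ π₂ ∈ NC2 (k + 1) := by
  have hm := @mem_gluePairing k j hj π₁ π₂ h₁ h₂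
  obtain ⟨s₁, e₁, u₁, n₁⟩ := mem_NC2.mp h₁
  obtain ⟨s₂, e₂, u₂, n₂⟩ := mem_NC2.mp h₂
  rw [mem_NC2]
  refine ⟨fun a c h => ?_, fun i hi => ?_, fun a c a' c' h h' => ?_, fun a c a' c' h h' => ?_⟩
  · rcases hm.mp h with h | ⟨x, y, rfl, rfl, g⟩ | ⟨x, y, rfl, rfl, g⟩
    · omega
    · have := s₁ _ _ g; omega
    · have := s₂ _ _ g; omega
  · rcases Nat.eq_zero_or_pos i with rfl | hi0
    · exact ⟨1 + j, Or.inr (hm.mpr (by simp))⟩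
    rcases lt_trichotomy i (1 + j) with h | rfl | h
    · obtain ⟨a, h⟩ := e₁ (i - 1) (by omega)
      refine ⟨1 + a, h.imp (fun h => ?_) fun h => ?_⟩
      · exact hm.mpr (Or.inr (Or.inl ⟨_, _, rfl, by omega, h⟩))
      · exact hm.mpr (Or.inr (Or.inl ⟨_, _, by omega, rfl, h⟩))
    · exact ⟨0, Or.inl (hm.mpr (by simp))⟩
    · obtain ⟨a, h⟩ := e₂ (i - (2 + j)) (by omega)
      refine ⟨2 + j + a, h.imp (fun h => ?_) fun h => ?_⟩
      · exact hm.mpr (Or.inr (Or.inr ⟨_, _, rfl, by omega, h⟩))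
      · exact hm.mpr (Or.inr (Or.inr ⟨_, _, by omega, rfl, h⟩))
  · rcases hm.mp h with ⟨rfl, rfl⟩ | ⟨x, y, rfl, rfl, g⟩ | ⟨x, y, rfl, rfl, g⟩ <;>
    rcases hm.mp h' with ⟨rfl, rfl⟩ | ⟨x', y', rfl, rfl, g'⟩ | ⟨x', y', rfl, rfl, g'⟩
    · omega
    · have := s₁ _ _ g'; omega
    · have := s₂ _ _ g'; omega
    · have := s₁ _ _ g; omega
    · have := u₁ _ _ _ _ g g'; omega
    · have := s₁ _ _ g; have := s₂ _ _ g'; omega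
    · have := s₂ _ _ g; omega
    · have := s₁ _ _ g'; have := s₂ _ _ g; omega
    · have := u₂ _ _ _ _ g g'; omega
  · rcases hm.mp h with ⟨rfl, rfl⟩ | ⟨x, y, rfl, rfl, g⟩ | ⟨x, y, rfl, rfl, g⟩ <;>
    rcases hm.mp h' with ⟨rfl, rfl⟩ | ⟨x', y', rfl, rfl, g'⟩ | ⟨x', y', rfl, rfl, g'⟩
    · omega
    · have := s₁ _ _ g'; omega
    · have := s₂ _ _ g'; omega
    · have := s₁ _ _ g; omega
    · have := n₁ _ _ _ _ g g'; omega
    · have := s₁ _ _ g; have := s₂ _ _ g'; omega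
    · have := s₂ _ _ g; omega
    · have := s₁ _ _ g'; have := s₂ _ _ g; omega
    · have := n₂ _ _ _ _ g g'; omega

/-- A block straddling the point `1 + j` would cross the block of 0, so every other block lies
inside it or to its right. -/
theorem pair_cases {k j : ℕ} {π : Finset (ℕ × ℕ)} (hπ : π ∈ NC2 (k + 1)) (h0 : (0, 1 + j) ∈ π)
    {a c : ℕ} (h : (a, c) ∈ π) :
    (a = 0 ∧ c = 1 + j) ∨ (0 < a ∧ a < c ∧ c < 1 + j) ∨ (1 + j < a ∧ a < c ∧ c < k + 1) := by
  obtain ⟨s, e, u, n⟩ := mem_NC2.mp hπ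
  have s1 := s _ _ h
  have h1 := u _ _ _ _ h h0
  have h2 := u _ _ _ _ h0 h
  have h3 := n _ _ _ _ h0 h
  omega

theorem restrictPairing_mem_left {k j : ℕ} {π : Finset (ℕ × ℕ)} (hj : j < k)
    (hπ : π ∈ NC2 (k + 1)) (h0 : (0, 1 + j) ∈ π) : restrictPairing π 1 j ∈ NC2 j := by
  obtain ⟨s, e, u, n⟩ := mem_NC2.mp hπ
  simp only [mem_NC2, mem_restrictPairing]
  refine ⟨fun a c h => ?_, fun i hi => ?_, fun a c a' c' h h' => ?_, fun a c a' c' h h' => ?_⟩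
  · have := s _ _ h.2; omega
  · obtain ⟨a, h⟩ := e (1 + i) (by omega)
    rcases h with h | h
    · have := pair_cases hπ h0 h
      exact ⟨a - 1, Or.inl ⟨by omega, by rwa [Nat.add_sub_cancel' (by omega)]⟩⟩
    · have := pair_cases hπ h0 h
      exact ⟨a - 1, Or.inr ⟨by omega, by rwa [Nat.add_sub_cancel' (by omega)]⟩⟩
  · have := u _ _ _ _ h.2 h'.2; omega
  · have := n _ _ _ _ h.2 h'.2; omega

theorem restrictPairing_mem_right {k j : ℕ} {π : Finset (ℕ × ℕ)} (hj : j < k)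
    (hπ : π ∈ NC2 (k + 1)) (h0 : (0, 1 + j) ∈ π) :
    restrictPairing π (2 + j) (k - 1 - j) ∈ NC2 (k - 1 - j) := by
  obtain ⟨s, e, u, n⟩ := mem_NC2.mp hπ
  simp only [mem_NC2, mem_restrictPairing]
  refine ⟨fun a c h => ?_, fun i hi => ?_, fun a c a' c' h h' => ?_, fun a c a' c' h h' => ?_⟩
  · have := s _ _ h.2; omega
  · obtain ⟨a, h⟩ := e (2 + j + i) (by omega)
    rcases h with h | h
    · have := pair_cases hπ h0 h
      exact ⟨a - (2 + j), Or.inl ⟨by omega, by rwa [Nat.add_sub_cancel' (by omega)]⟩⟩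
    · have := pair_cases hπ h0 h
      exact ⟨a - (2 + j), Or.inr ⟨by omega, by rwa [Nat.add_sub_cancel' (by omega)]⟩⟩
  · have := u _ _ _ _ h.2 h'.2; omega
  · have := n _ _ _ _ h.2 h'.2; omega

theorem gluePairing_restrictPairing {k j : ℕ} {π : Finset (ℕ × ℕ)} (hj : j < k)
    (hπ : π ∈ NC2 (k + 1)) (h0 : (0, 1 + j) ∈ π) :
    gluePairing k j (restrictPairing π 1 j) (restrictPairing π (2 + j) (k - 1 - j)) = π := by
  ext ⟨a, c⟩
  rw [mem_gluePairing hj (restrictPairing_mem_left hj hπ h0) (restrictPairing_mem_right hj hπ h0)]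
  simp only [mem_restrictPairing]
  constructor
  · rintro (⟨rfl, rfl⟩ | ⟨a', c', rfl, rfl, h⟩ | ⟨a', c', rfl, rfl, h⟩)
    · exact h0
    · exact h.2
    · exact h.2
  · intro h
    rcases pair_cases hπ h0 h with h' | h' | h'
    · exact Or.inl h'
    · obtain ⟨a, rfl⟩ := Nat.exists_eq_add_of_le (show 1 ≤ a by omega)
      obtain ⟨c, rfl⟩ := Nat.exists_eq_add_of_le (show 1 ≤ c by omega)
      exact Or.inr (Or.inl ⟨a, c, rfl, rfl, by omega, h⟩)
    · obtain ⟨a, rfl⟩ := Nat.exists_eq_add_of_le (show 2 + j ≤ a by omega)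
      obtain ⟨c, rfl⟩ := Nat.exists_eq_add_of_le (show 2 + j ≤ c by omega)
      exact Or.inr (Or.inr ⟨a, c, rfl, rfl, by omega, h⟩)

theorem restrictPairing_gluePairing_left {k j : ℕ} (hj : j < k) {π₁ π₂ : Finset (ℕ × ℕ)}
    (h₁ : π₁ ∈ NC2 j) (h₂ : π₂ ∈ NC2 (k - 1 - j)) :
    restrictPairing (gluePairing k j π₁ π₂) 1 j = π₁ := by
  ext ⟨a, c⟩
  rw [mem_restrictPairing, mem_gluePairing hj h₁ h₂]
  constructor
  · rintro ⟨hac, h | ⟨a', c', ha, hc, h⟩ | ⟨a', c', ha, hc, h⟩⟩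
    · omega
    · obtain rfl : a = a' := by omega
      obtain rfl : c = c' := by omega
      exact h
    · omega
  · intro h
    have := (mem_NC2.mp h₁).1 _ _ h
    exact ⟨by omega, Or.inr (Or.inl ⟨a, c, rfl, rfl, h⟩)⟩

theorem restrictPairing_gluePairing_right {k j : ℕ} (hj : j < k) {π₁ π₂ : Finset (ℕ × ℕ)}
    (h₁ : π₁ ∈ NC2 j) (h₂ : π₂ ∈ NC2 (k - 1 - j)) :
    restrictPairing (gluePairing k j π₁ π₂) (2 + j) (k - 1 - j) = π₂ := by
  ext ⟨a, c⟩
  rw [mem_restrictPairing, mem_gluePairing hj h₁ h₂]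
  constructor
  · rintro ⟨hac, h | ⟨a', c', ha, hc, h⟩ | ⟨a', c', ha, hc, h⟩⟩
    · omega
    · have := (mem_NC2.mp h₁).1 _ _ h
      omega
    · obtain rfl : a = a' := by omega
      obtain rfl : c = c' := by omega
      exact h
  · intro h
    have := (mem_NC2.mp h₂).1 _ _ h
    exact ⟨by omega, Or.inr (Or.inr ⟨a, c, rfl, rfl, h⟩)⟩

/-- The moment `∑_{π ∈ NC₂(k)} b_0 η_π(b_1, …, b_{k-1}) b_k`. -/
def semicircularMoment {B : Type*} [Ring B] (η : B → B) (b : ℕ → B) (k : ℕ) : B :=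
  ∑ π ∈ NC2 k, multFunctional η π b k 0

/-- Pairings are sorted by the partner `1 + j` of the first point. Cutting and gluing at this block
identify those with given `j` with pairs of pairings of the `j` points inside and the `k - 1 - j`
points to the right; additivity of `η` moves the inner sum inside. -/
theorem semicircularMoment_succ {B F : Type*} [Ring B] [FunLike F B B] [AddMonoidHomClass F B B]
    (η : F) (b : ℕ → B) (k : ℕ) : semicircularMoment η b (k + 1) =
      ∑ j ∈ Finset.range k, b 0 * η (semicircularMoment η (fun i => b (1 + i)) j) *
        semicircularMoment η (fun i => b (2 + j + i)) (k - 1 - j) := by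
  rw [Finset.sum_range]
  unfold semicircularMoment
  simp_rw [multFunctional]
  rw [Finset.sum_comm]
  refine Finset.sum_congr rfl fun j _ => ?_
  have hj := j.2
  rw [map_sum, mul_assoc, Finset.sum_mul_sum, ← Finset.sum_product', Finset.mul_sum,
    ← Finset.sum_filter]
  refine Finset.sum_bij' (fun π _ => (restrictPairing π 1 j, restrictPairing π (2 + j) (k - 1 - j)))
    (fun p _ => gluePairing k j p.1 p.2) ?_ ?_ ?_ ?_ ?_
  · intro π hπ
    rw [Finset.mem_filter, zero_add] at hπ
    exact Finset.mem_product.mpr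
      ⟨restrictPairing_mem_left hj hπ.1 hπ.2, restrictPairing_mem_right hj hπ.1 hπ.2⟩
  · intro p hp
    rw [Finset.mem_product] at hp
    rw [Finset.mem_filter, zero_add, mem_gluePairing hj hp.1 hp.2]
    exact ⟨gluePairing_mem hj hp.1 hp.2, by simp⟩
  · intro π hπ
    rw [Finset.mem_filter, zero_add] at hπ
    exact gluePairing_restrictPairing hj hπ.1 hπ.2
  · intro p hp
    rw [Finset.mem_product] at hp
    exact Prod.ext (restrictPairing_gluePairing_left hj hp.1 hp.2)
      (restrictPairing_gluePairing_right hj hp.1 hp.2)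
  · intro π hπ
    rw [← mul_assoc, multFunctional_congr η j (0 + 1) 0 (π' := restrictPairing π 1 j)
        (b' := fun i => b (1 + i)),
      multFunctional_congr η (k - 1 - j) (0 + 2 + j) 0
        (π' := restrictPairing π (2 + j) (k - 1 - j)) (b' := fun i => b (2 + j + i))]
    · intro a ha c hc
      simp [mem_restrictPairing, ha, hc]
    · intro a _
      simp
    · intro a ha c hc
      simp [mem_restrictPairing, ha, hc]
    · intro a _
      simp

end PairingSums

/-! ### Monomials in one letter -/

namespace BPoly

variable {B : Type*} [Ring B] [Algebra ℂ B]

/-- The monomial `b_0 X b_1 X ⋯ X b_k`. -/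
def monomial (b : ℕ → B) : ℕ → BPoly B Unit
  | 0 => C (b 0)
  | k + 1 => monomial b k * X () * C (b (k + 1))

theorem monomial_congr {b b' : ℕ → B} (k : ℕ) (h : ∀ i ≤ k, b i = b' i) :
    monomial b k = monomial b' k := by
  induction k with
  | zero => rw [monomial, monomial, h 0 le_rfl]
  | succ k ih => rw [monomial, monomial, h _ le_rfl, ih fun i hi => h i (by omega)]

theorem fdq_monomial (b : ℕ → B) (k : ℕ) :
    fdq () (monomial b k) = ∑ j ∈ Finset.range k,
      monomial b j ⊗ₜ monomial (fun i => b (1 + j + i)) (k - 1 - j) := by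
  induction k with
  | zero => simp [monomial]
  | succ k ih =>
    rw [monomial, fdq_mul, fdq_mul, ih, fdq_C, mul_zero, zero_add, fdq_X,
      if_pos rfl, Finset.sum_range_succ, add_mul, add_comm]
    congr 1
    · rw [Finset.sum_mul, Finset.sum_mul]
      refine Finset.sum_congr rfl fun j hj => ?_
      rw [Finset.mem_range] at hj
      obtain ⟨m, rfl⟩ := Nat.exists_eq_add_of_lt hj
      rw [show j + m + 1 - 1 - j = m by omega, show j + m + 1 + 1 - 1 - j = m + 1 by omega,
        monomial]
      simp only [Algebra.TensorProduct.tmul_mul_tmul, mul_one]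
      congr 4
      omega
    · rw [show k + 1 - 1 - k = 0 by omega, monomial]
      simp [add_comm]

/-- The span of the monomials contains 1 and is stable under right multiplication by the generators:
a coefficient is absorbed into the last one, a letter appends a new coefficient 1. -/
theorem mem_span_monomial (P : BPoly B Unit) :
    P ∈ Submodule.span ℂ {Q | ∃ (b : ℕ → B) (k : ℕ), Q = monomial b k} := by
  set M := Submodule.span ℂ {Q : BPoly B Unit | ∃ (b : ℕ → B) (k : ℕ), Q = monomial b k}
  have key : ∀ P : BPoly B Unit, ∀ v ∈ M, v * P ∈ M := by
    have red : ∀ P : BPoly B Unit, (∀ b k, monomial b k * P ∈ M) → ∀ v ∈ M, v * P ∈ M := by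
      intro P h v hv
      induction hv using Submodule.span_induction with
      | mem v hv => obtain ⟨b, k, rfl⟩ := hv; exact h b k
      | zero => simp
      | add x y _ _ hx hy => rw [add_mul]; exact M.add_mem hx hy
      | smul r x _ hx => rw [smul_mul_assoc]; exact M.smul_mem _ hx
    intro P
    induction P using induction with
    | hC c =>
      refine red _ fun b k => Submodule.subset_span ⟨Function.update b k (b k * c), k, ?_⟩
      cases k with
      | zero => simp [monomial]
      | succ k =>
        rw [monomial, monomial, Function.update_self, map_mul, ← mul_assoc]
        congr 3
        exact monomial_congr k fun i hi => by rw [Function.update_of_ne (by omega)]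
    | hX i =>
      refine red _ fun b k => Submodule.subset_span ⟨Function.update b (k + 1) 1, k + 1, ?_⟩
      rw [monomial, Function.update_self, map_one, mul_one]
      congr 1
      exact monomial_congr k fun i hi => by rw [Function.update_of_ne (by omega)]
    | hadd P Q hP hQ => intro v hv; rw [mul_add]; exact M.add_mem (hP v hv) (hQ v hv)
    | hmul P Q hP hQ => intro v hv; rw [← mul_assoc]; exact hQ _ (hP v hv)
  have := key P 1 (Submodule.subset_span ⟨fun _ => 1, 0, by simp [monomial]⟩)
  rwa [one_mul] at this

end BPoly

/-! ### Conditional expectation, annihilation maps and the one-letter Schwinger–Dyson equation -/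

namespace TracialSpace

variable {A B : Type*} [CStarAlgebra A] [PartialOrder A] [StarOrderedRing A]
  [CStarAlgebra B] [PartialOrder B] [StarOrderedRing B] (𝔄 : TracialSpace A B)

section Basic

variable {ι : Type*}

@[simp] theorem ev_C (Y : ι → A) (b : B) : 𝔄.ev Y (BPoly.C b) = 𝔄.incl b :=
  BPoly.lift_C _ _ _

@[simp] theorem ev_X (Y : ι → A) (i : ι) : 𝔄.ev Y (BPoly.X i) = Y i :=
  BPoly.lift_X _ _ _

theorem E_incl_mul (b : B) (a : A) : 𝔄.E (𝔄.incl b * a) = b * 𝔄.E a := by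
  simpa using 𝔄.E_bimodule b a 1

theorem E_mul_incl (a : A) (b : B) : 𝔄.E (a * 𝔄.incl b) = 𝔄.E a * b := by
  simpa using 𝔄.E_bimodule 1 a b

theorem τ_incl_mul (b : B) (a : A) : 𝔄.τ (𝔄.incl b * a) = 𝔄.τ (𝔄.incl (b * 𝔄.E a)) := by
  rw [← 𝔄.τ_E, E_incl_mul]

theorem τ_mul_incl (a : A) (b : B) : 𝔄.τ (a * 𝔄.incl b) = 𝔄.τ (𝔄.incl (𝔄.E a * b)) := by
  rw [← 𝔄.τ_E, E_mul_incl]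

/-- Testing against the adjoint of y = E[a - a'] gives τ(y*y) = 0, and τ is faithful. -/
theorem E_eq_of_τ {a a' : A} (h : ∀ b, 𝔄.τ (a * 𝔄.incl b) = 𝔄.τ (a' * 𝔄.incl b)) :
    𝔄.E a = 𝔄.E a' := by
  rw [← sub_eq_zero, ← map_sub]
  set y := 𝔄.E (a - a') with hy
  have h1 : 𝔄.τ ((a - a') * 𝔄.incl (star y)) = 0 := by rw [sub_mul, map_sub, h, sub_self]
  rw [τ_mul_incl, ← hy, map_mul, 𝔄.τ_comm, map_star] at h1
  have h2 := 𝔄.τ_faithful _ h1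
  exact 𝔄.incl_injective (by rw [h2, map_zero])

end Basic

section ConjugateFunctional

variable {ι : Type*} (η : B →CP B) (Y : ι → A)

/-- The map `P ⊗ Q ↦ η(E[P(Y)]) Q(Y)`. -/
def etaLeft : BPoly B ι ⊗[ℂ] BPoly B ι →ₗ[ℂ] A :=
  LinearMap.mul' ℂ A ∘ₗ TensorProduct.map
    (𝔄.incl.toAlgHom.toLinearMap ∘ₗ η.toLinearMap ∘ₗ 𝔄.E.toLinearMap ∘ₗ (𝔄.ev Y).toLinearMap)
    (𝔄.ev Y).toLinearMap

@[simp] theorem etaLeft_tmul (P Q : BPoly B ι) :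
    𝔄.etaLeft η Y (P ⊗ₜ Q) = 𝔄.incl (η (𝔄.E (𝔄.ev Y P))) * 𝔄.ev Y Q := rfl

theorem etaLeft_mul_one_tmul (T : BPoly B ι ⊗[ℂ] BPoly B ι) (Q : BPoly B ι) :
    𝔄.etaLeft η Y (T * 1 ⊗ₜ Q) = 𝔄.etaLeft η Y T * 𝔄.ev Y Q := by
  induction T using TensorProduct.induction_on with
  | zero => simp
  | add x y hx hy => rw [add_mul, map_add, hx, hy, map_add, add_mul]
  | tmul p q => simp [mul_assoc]

variable [DecidableEq ι]

/-- The map `P ↦ (η E ⊗ id)(∂_j P)`, which acts on Wick words as the left annihilation operator. -/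
def annih (j : ι) : BPoly B ι →ₗ[ℂ] A := 𝔄.etaLeft η Y ∘ₗ BPoly.fdq j

theorem annih_apply (j : ι) (P : BPoly B ι) :
    𝔄.annih η Y j P = 𝔄.etaLeft η Y (BPoly.fdq j P) := rfl

@[simp] theorem annih_C (j : ι) (b : B) : 𝔄.annih η Y j (BPoly.C b) = 0 := by
  simp [annih_apply]

@[simp] theorem annih_one (j : ι) : 𝔄.annih η Y j 1 = 0 := by
  rw [← map_one BPoly.C, annih_C]

theorem annih_mul_C (j : ι) (P : BPoly B ι) (b : B) :
    𝔄.annih η Y j (P * BPoly.C b) = 𝔄.annih η Y j P * 𝔄.incl b := by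
  rw [annih_apply, BPoly.fdq_mul, BPoly.fdq_C, mul_zero, zero_add, etaLeft_mul_one_tmul, ev_C,
    annih_apply]

theorem annih_mul_X (j i : ι) (P : BPoly B ι) :
    𝔄.annih η Y j (P * BPoly.X i) = 𝔄.annih η Y j P * Y i +
      if i = j then 𝔄.incl (η (𝔄.E (𝔄.ev Y P))) else 0 := by
  rw [annih_apply, BPoly.fdq_mul, BPoly.fdq_X, map_add, etaLeft_mul_one_tmul, ev_X,
    annih_apply, add_comm]
  split_ifs <;> simp

end ConjugateFunctional

section OneVariable

variable (η : B →CP B) (s : A)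

theorem ev_monomial (b : ℕ → B) (k : ℕ) :
    𝔄.ev (fun _ => s) (BPoly.monomial b k) = 𝔄.word s b k := by
  induction k with
  | zero => simp [BPoly.monomial, word]
  | succ k ih => simp [BPoly.monomial, word, ih]

theorem word_cons (b : ℕ → B) (k : ℕ) :
    𝔄.word s (fun i => if i = 0 then 1 else b (i - 1)) (k + 1) = s * 𝔄.word s b k := by
  induction k with
  | zero => simp [word]
  | succ k ih => rw [word, ih]; simp [word, mul_assoc]

variable {η s}

/-- The Schwinger–Dyson equation of a semicircular element. -/
theorem IsSemicircular.E_mul_ev (hs : 𝔄.IsSemicircular η s) (P : BPoly B Unit) :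
    𝔄.E (s * 𝔄.ev (fun _ => s) P) = 𝔄.E (𝔄.annih η (fun _ => s) () P) := by
  induction BPoly.mem_span_monomial P using Submodule.span_induction with
  | zero => simp
  | add x y _ _ hx hy => simp only [map_add, mul_add, hx, hy]
  | smul r x _ hx => simp only [map_smul, mul_smul_comm, hx]
  | mem P hP =>
    obtain ⟨b, k, rfl⟩ := hP
    have hm : ∀ (b : ℕ → B) k, 𝔄.E (𝔄.word s b k) = semicircularMoment η b k := fun b k => hs.2 k b
    -- With coefficient 1 put in front, the leading `s` is the first point of the pairing. Its
    -- partner is one of the letters of the monomial, and pairing with the `j`-th of them matches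
    -- the `j`-th term of the difference quotient.
    rw [ev_monomial, ← word_cons, hm, semicircularMoment_succ, annih_apply, BPoly.fdq_monomial, map_sum,
      map_sum]
    refine Finset.sum_congr rfl fun j _ => ?_
    rw [etaLeft_tmul, ev_monomial, ev_monomial, E_incl_mul, hm, hm, if_pos rfl, one_mul]
    congr 2
    · simp
    · funext i
      rw [if_neg (by omega)]
      congr 1
      omega

theorem IsSemicircular.E_mul_incl_mul (hs : 𝔄.IsSemicircular η s) (b : B) :
    𝔄.E (s * 𝔄.incl b * s) = η b := by
  have h := hs.E_mul_ev 𝔄 (BPoly.C b * BPoly.X ())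
  rwa [annih_mul_X, annih_C, zero_mul, zero_add, if_pos rfl, ev_C, 𝔄.E_incl, 𝔄.E_incl,
    map_mul (𝔄.ev _), ev_C, ev_X, ← mul_assoc] at h

/-- Since η(b) = E[s b s], both sides are cyclic rotations of τ(s b s c): the trace forces η to be
τ-symmetric. -/
theorem IsSemicircular.τ_eta_mul (hs : 𝔄.IsSemicircular η s) (b c : B) :
    𝔄.τ (𝔄.incl (η b * c)) = 𝔄.τ (𝔄.incl (b * η c)) := by
  have h1 : 𝔄.τ (𝔄.incl (η b * c)) = 𝔄.τ (s * 𝔄.incl b * s * 𝔄.incl c) := by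
    rw [← hs.E_mul_incl_mul, ← E_mul_incl, 𝔄.τ_E]
  have h2 : 𝔄.τ (𝔄.incl (b * η c)) = 𝔄.τ (𝔄.incl b * (s * 𝔄.incl c * s)) := by
    rw [← hs.E_mul_incl_mul, ← E_incl_mul, 𝔄.τ_E]
  rw [h1, h2]
  simp only [mul_assoc]
  rw [𝔄.τ_comm]
  simp only [mul_assoc]

end OneVariable

end TracialSpace

/-! ### Freeness and the Schwinger–Dyson equation for several letters -/

namespace BPoly

variable {B : Type*} [Ring B] [Algebra ℂ B] {ι : Type*}

/-- The embedding `B⟨X⟩ → B⟨X_i : i ∈ ι⟩`, `X ↦ X_i`. -/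
def single (i : ι) : BPoly B Unit →ₐ[ℂ] BPoly B ι := lift C fun _ => X i

@[simp] theorem single_C (i : ι) (b : B) : single i (C b) = C b := lift_C _ _ _

@[simp] theorem single_X (i : ι) (u : Unit) : single i (X u : BPoly B Unit) = X i := lift_X _ _ _

theorem fdq_single [DecidableEq ι] (j i : ι) (P : BPoly B Unit) :
    fdq j (single i P) = if i = j then
      Algebra.TensorProduct.map (single i) (single i) (fdq () P) else 0 := by
  induction P using BPoly.induction with
  | hC b => simp
  | hX u =>
    simp only [single_X, fdq_X, if_true]
    split_ifs <;> simp
  | hadd P Q hP hQ =>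
    simp only [map_add, hP, hQ]
    split_ifs <;> simp
  | hmul P Q hP hQ =>
    rw [map_mul, fdq_mul, fdq_mul, hP, hQ]
    split_ifs <;> simp

theorem mem_of_mul_mem (M : Submodule ℂ (BPoly B ι)) (h1 : 1 ∈ M)
    (hC : ∀ b, ∀ P ∈ M, C b * P ∈ M) (hX : ∀ i, ∀ P ∈ M, X i * P ∈ M) (P : BPoly B ι) : P ∈ M := by
  have key : ∀ P : BPoly B ι, ∀ v ∈ M, P * v ∈ M := by
    intro P
    induction P using BPoly.induction with
    | hC b => exact hC b
    | hX i => exact hX i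
    | hadd P Q hP hQ => intro v hv; rw [add_mul]; exact M.add_mem (hP v hv) (hQ v hv)
    | hmul P Q hP hQ => intro v hv; rw [mul_assoc]; exact hP _ (hQ v hv)
  simpa using key P 1 h1

end BPoly

namespace TracialSpace

variable {A B : Type*} [CStarAlgebra A] [PartialOrder A] [StarOrderedRing A]
  [CStarAlgebra B] [PartialOrder B] [StarOrderedRing B] (𝔄 : TracialSpace A B)
  {d : ℕ} (S : Fin d → A)

theorem ev_single (i : Fin d) (P : BPoly B Unit) :
    𝔄.ev S (BPoly.single i P) = 𝔄.ev (fun _ => S i) P := by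
  have : (𝔄.ev S).comp (BPoly.single i) = 𝔄.ev (fun _ => S i) :=
    BPoly.algHom_ext (by simp) (by simp)
  exact DFunLike.congr_fun this P

/-- The polynomial `P(X_i) - E[P(S_i)]`. -/
def centered (p : Fin d × BPoly B Unit) : BPoly B (Fin d) :=
  BPoly.single p.1 p.2 - BPoly.C (𝔄.E (𝔄.ev (fun _ => S p.1) p.2))

theorem single_eq (i : Fin d) (P : BPoly B Unit) : BPoly.single i P =
    𝔄.centered S (i, P) + BPoly.C (𝔄.E (𝔄.ev (fun _ => S i) P)) := by
  simp [centered]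

/-- A product of centered polynomials in one letter each. -/
def centeredProd (l : List (Fin d × BPoly B Unit)) : BPoly B (Fin d) :=
  (l.map (𝔄.centered S)).prod

@[simp] theorem centeredProd_nil : 𝔄.centeredProd S [] = 1 := rfl

@[simp] theorem centeredProd_cons (p : Fin d × BPoly B Unit) (l : List (Fin d × BPoly B Unit)) :
    𝔄.centeredProd S (p :: l) = 𝔄.centered S p * 𝔄.centeredProd S l := by
  simp [centeredProd]

theorem centeredProd_append (l l' : List (Fin d × BPoly B Unit)) :
    𝔄.centeredProd S (l ++ l') = 𝔄.centeredProd S l * 𝔄.centeredProd S l' := by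
  simp [centeredProd]

/-- Neighbours in the list belong to different letters. -/
abbrev Alternating (l : List (Fin d × BPoly B Unit)) : Prop := (l.map Prod.fst).IsChain (· ≠ ·)

variable {S}

theorem IsFree.E_centeredProd (hS : 𝔄.IsFree S) {l : List (Fin d × BPoly B Unit)} (hl : l ≠ [])
    (hc : Alternating l) : 𝔄.E (𝔄.ev S (𝔄.centeredProd S l)) = 0 := by
  obtain ⟨p, t, rfl⟩ := List.exists_cons_of_ne_nil hl
  have h := hS t.length (fun m => ((p :: t).get m).2) (fun m => ((p :: t).get m).1) ?_
  · rw [← h]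
    congr 1
    rw [centeredProd, map_list_prod, List.map_map]
    conv_lhs => rw [← List.ofFn_get (p :: t), List.map_ofFn]
    congr 2
    funext m
    simp [centered, ev_single]
  · intro m
    have := List.isChain_iff_getElem.mp hc m (by simp)
    rw [List.getElem_map, List.getElem_map] at this
    exact this

/-- The first factor need not be centered: its mean is a coefficient that leaves `E`, and the
nonempty alternating tail still has expectation zero. -/
theorem IsFree.E_single_mul (hS : 𝔄.IsFree S) {i : Fin d} {P : BPoly B Unit}
    {l : List (Fin d × BPoly B Unit)} (hl : l ≠ []) (hc : Alternating ((i, P) :: l)) :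
    𝔄.E (𝔄.ev S (BPoly.single i P * 𝔄.centeredProd S l)) = 0 := by
  rw [𝔄.single_eq S, add_mul, map_add, map_add, ← centeredProd_cons, hS.E_centeredProd 𝔄 (by simp) hc,
    map_mul, ev_C, E_incl_mul, hS.E_centeredProd 𝔄 hl hc.tail, mul_zero, add_zero]

theorem IsFree.E_mul_single (hS : 𝔄.IsFree S) {i : Fin d} {P : BPoly B Unit}
    {l : List (Fin d × BPoly B Unit)} (hl : l ≠ []) (hc : Alternating (l ++ [(i, P)])) :
    𝔄.E (𝔄.ev S (𝔄.centeredProd S l * BPoly.single i P)) = 0 := by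
  have h := hS.E_centeredProd 𝔄 (by simp) hc
  rw [centeredProd_append, centeredProd_cons, centeredProd_nil, mul_one] at h
  rw [𝔄.single_eq S, mul_add, map_add, map_add, h,
    map_mul, ev_C, E_mul_incl, hS.E_centeredProd 𝔄 hl ?_, zero_mul, add_zero]
  rw [Alternating, List.map_append] at hc
  exact hc.left_of_append

/-- Every left leg produced here is a nonempty alternating product ending in one possibly uncentered
factor, so `E` kills it. Consequently, under η E ⊗ id only the derivative of the first factor of an
alternating product survives. -/
theorem IsFree.etaLeft_mul_fdq (hS : 𝔄.IsFree S) (η : B →CP B) (j : Fin d)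
    (l l' : List (Fin d × BPoly B Unit)) (hl : l ≠ []) (hc : Alternating (l ++ l')) :
    𝔄.etaLeft η S (𝔄.centeredProd S l ⊗ₜ 1 * BPoly.fdq j (𝔄.centeredProd S l')) = 0 := by
  induction l' generalizing l with
  | nil => rw [centeredProd_nil, ← map_one BPoly.C, BPoly.fdq_C, mul_zero, map_zero]
  | cons p t ih =>
    obtain ⟨i, P⟩ := p
    -- In the Leibniz rule, differentiating the tail moves the head into the left block, where the
    -- induction hypothesis applies.
    have h2 := ih (l ++ [(i, P)]) (by simp) (by simpa using hc)
    rw [centeredProd_append, centeredProd_cons, centeredProd_nil, mul_one] at h2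
    rw [centeredProd_cons, BPoly.fdq_mul, mul_add, ← mul_assoc, ← mul_assoc,
      Algebra.TensorProduct.tmul_mul_tmul, mul_one, map_add, h2, zero_add, etaLeft_mul_one_tmul]
    have h3 : ∀ T, 𝔄.etaLeft η S (𝔄.centeredProd S l ⊗ₜ 1 *
        Algebra.TensorProduct.map (BPoly.single i) (BPoly.single i) T) = 0 := by
      intro T
      induction T using TensorProduct.induction_on with
      | zero => simp
      | add x y hx hy => rw [map_add, mul_add, map_add, hx, hy, add_zero]
      | tmul p q =>
        rw [Algebra.TensorProduct.map_tmul, Algebra.TensorProduct.tmul_mul_tmul, etaLeft_tmul,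
          hS.E_mul_single 𝔄 hl, map_zero, map_zero, zero_mul]
        have hc' : ((l.map Prod.fst ++ [i]) ++ t.map Prod.fst).IsChain (· ≠ ·) := by
          simpa only [Alternating, List.map_append, List.map_cons, List.append_assoc,
            List.singleton_append]
            using hc
        simpa only [Alternating, List.map_append, List.map_cons, List.map_nil]
          using hc'.left_of_append
    rw [centered, map_sub, BPoly.fdq_C, sub_zero, BPoly.fdq_single]
    split_ifs
    · rw [h3, zero_mul]
    · rw [mul_zero, map_zero, zero_mul]

variable (S) in
-- The span is a left ideal containing 1. Multiplying by X_j either merges with a first factor in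
-- the same letter, which is then recentered, or prepends a new factor.
theorem mem_span_centeredProd (P : BPoly B (Fin d)) :
    P ∈ Submodule.span ℂ ({Q | ∃ b, Q = BPoly.C b} ∪
      {Q | ∃ l, l ≠ [] ∧ Alternating l ∧ Q = 𝔄.centeredProd S l}) := by
  set G : Set (BPoly B (Fin d)) := {Q | ∃ b, Q = BPoly.C b} ∪
      {Q | ∃ l, l ≠ [] ∧ Alternating l ∧ Q = 𝔄.centeredProd S l} with hG
  set M := Submodule.span ℂ G
  have red : ∀ P, (∀ v ∈ G, P * v ∈ M) → ∀ v ∈ M, P * v ∈ M := by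
    intro P h v hv
    induction hv using Submodule.span_induction with
    | mem v hv => exact h v hv
    | zero => simp
    | add x y _ _ hx hy => rw [mul_add]; exact M.add_mem hx hy
    | smul r x _ hx => rw [mul_smul_comm]; exact M.smul_mem _ hx
  have mC : ∀ b, BPoly.C b ∈ M := fun b => Submodule.subset_span (Or.inl ⟨b, rfl⟩)
  have mP : ∀ l, Alternating l → 𝔄.centeredProd S l ∈ M := fun l hl => by
    by_cases h : l = []
    · rw [h, centeredProd_nil, ← map_one BPoly.C]; exact mC 1
    · exact Submodule.subset_span (Or.inr ⟨l, h, hl, rfl⟩)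
  have hC : ∀ b, ∀ v ∈ M, BPoly.C b * v ∈ M := fun b => by
    refine red _ ?_
    rintro _ (⟨c, rfl⟩ | ⟨l, hl, hc, rfl⟩)
    · rw [← map_mul]; exact mC _
    · obtain ⟨⟨i, P⟩, t, rfl⟩ := List.exists_cons_of_ne_nil hl
      have : BPoly.C b * 𝔄.centeredProd S ((i, P) :: t) =
          𝔄.centeredProd S ((i, BPoly.C b * P) :: t) := by
        rw [centeredProd_cons, centeredProd_cons, ← mul_assoc]
        simp [centered, E_incl_mul, mul_sub]
      rw [this]
      exact mP _ hc
  have mS : ∀ i P l, Alternating ((i, P) :: l) →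
      BPoly.single i P * 𝔄.centeredProd S l ∈ M := fun i P l hl => by
    rw [𝔄.single_eq S, add_mul, ← centeredProd_cons]
    exact M.add_mem (mP _ hl) (hC _ _ (mP _ hl.tail))
  refine BPoly.mem_of_mul_mem M (by rw [← map_one BPoly.C]; exact mC 1) hC (fun j => red _ ?_) P
  rintro _ (⟨c, rfl⟩ | ⟨l, hl, hc, rfl⟩)
  · have := mS j (BPoly.X () * BPoly.C c) [] (by simp [Alternating])
    rwa [map_mul, BPoly.single_X, BPoly.single_C, centeredProd_nil, mul_one] at this
  · obtain ⟨⟨i, P⟩, t, rfl⟩ := List.exists_cons_of_ne_nil hl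
    by_cases hij : j = i
    · subst hij
      have := mS j (BPoly.X () * (P - BPoly.C (𝔄.E (𝔄.ev (fun _ => S j) P)))) t hc
      rw [centeredProd_cons, centered, ← mul_assoc]
      simpa [mul_sub] using this
    · simpa using mS j (BPoly.X ()) ((i, P) :: t) (List.isChain_cons_cons.mpr ⟨hij, hc⟩)

/-- The Schwinger–Dyson equation of a free semicircular system. -/
theorem IsFreeSemicircularSystem.E_mul_ev {η : Fin d → B →CP B}
    (hS : 𝔄.IsFreeSemicircularSystem η S) (j : Fin d) (P : BPoly B (Fin d)) :
    𝔄.E (S j * 𝔄.ev S P) = 𝔄.E (𝔄.annih (η j) S j P) := by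
  have hX : ∀ P : BPoly B Unit, 𝔄.E (S j * 𝔄.ev S (BPoly.single j P)) =
      𝔄.E (𝔄.annih (η j) S j (BPoly.single j P)) := by
    intro P
    have hT : ∀ T, 𝔄.etaLeft (η j) S (Algebra.TensorProduct.map (BPoly.single j) (BPoly.single j) T)
        = 𝔄.etaLeft (η j) (fun _ => S j) T := by
      intro T
      induction T using TensorProduct.induction_on with
      | zero => simp
      | add x y hx hy => rw [map_add, map_add, map_add, hx, hy]
      | tmul p q => simp [ev_single]
    rw [ev_single, (hS.2 j).E_mul_ev, annih_apply, annih_apply, BPoly.fdq_single, if_pos rfl, hT]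
  induction 𝔄.mem_span_centeredProd S P using Submodule.span_induction with
  | zero => simp
  | add x y _ _ hx hy => simp only [map_add, mul_add, hx, hy]
  | smul r x _ hx => simp only [map_smul, mul_smul_comm, hx]
  | mem P hP =>
    obtain ⟨c, rfl⟩ | ⟨l, hl, hc, rfl⟩ := hP
    · simpa using hX (BPoly.C c)
    · obtain ⟨⟨i, P⟩, t, rfl⟩ := List.exists_cons_of_ne_nil hl
      have h1 := hS.1.etaLeft_mul_fdq 𝔄 (η j) j [(i, P)] t (by simp) hc
      rw [centeredProd_cons, centeredProd_nil, mul_one] at h1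
      rw [annih_apply, centeredProd_cons, BPoly.fdq_mul, map_add, h1, zero_add, etaLeft_mul_one_tmul,
        ← annih_apply]
      by_cases hij : j = i
      · subst hij
        set Q := P - BPoly.C (𝔄.E (𝔄.ev (fun _ => S j) P)) with hQ
        have hcen : 𝔄.centered S (j, P) = BPoly.single j Q := by simp [hQ, centered]
        -- With a nonempty tail both sides vanish: the left is an uncentered factor times the tail,
        -- and on the right each η(E[p]) q(S_j) times the tail has expectation zero. Without a tail
        -- this is the one-letter case.
        rw [hcen]
        by_cases ht : t = []
        · subst ht
          simpa using hX Q
        · have h2 := hS.1.E_single_mul 𝔄 (P := BPoly.X () * Q) ht hc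
          rw [map_mul (BPoly.single j), BPoly.single_X, mul_assoc, map_mul (𝔄.ev S), ev_X] at h2
          rw [h2, annih_apply, BPoly.fdq_single, if_pos rfl]
          generalize BPoly.fdq () Q = T
          symm
          induction T using TensorProduct.induction_on with
          | zero => simp
          | add x y hx hy => rw [map_add, map_add, add_mul, map_add, hx, hy, add_zero]
          | tmul p q =>
            rw [Algebra.TensorProduct.map_tmul, etaLeft_tmul, mul_assoc, E_incl_mul, ← map_mul,
              hS.1.E_single_mul 𝔄 (P := q) ht hc, mul_zero]
      · have h2 := hS.1.E_single_mul 𝔄 (i := j) (P := BPoly.X ()) (l := (i, P) :: t) (by simp)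
          (List.isChain_cons_cons.mpr ⟨hij, hc⟩)
        rw [BPoly.single_X, map_mul, ev_X, centeredProd_cons] at h2
        rw [h2, annih_apply, centered, map_sub, BPoly.fdq_C, sub_zero, BPoly.fdq_single,
          if_neg (Ne.symm hij), map_zero, zero_mul, map_zero]

/-- Traciality carries a right factor of `U` to the right end of `V` as its adjoint, so `U` can be
built up generator by generator from 1, with `V` arbitrary throughout. -/
theorem IsFreeSemicircularSystem.τ_star_mul {η : Fin d → B →CP B}
    (hS : 𝔄.IsFreeSemicircularSystem η S) (j : Fin d) (U V : BPoly B (Fin d)) :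
    𝔄.τ (star (𝔄.ev S U) * S j * 𝔄.ev S V) = 𝔄.τ (star (𝔄.ev S U) * 𝔄.annih (η j) S j V) +
      𝔄.τ (star (𝔄.annih (η j) S j U) * 𝔄.ev S V) := by
  have key : ∀ P U : BPoly B (Fin d), (∀ V, 𝔄.τ (star (𝔄.ev S U) * S j * 𝔄.ev S V) =
      𝔄.τ (star (𝔄.ev S U) * 𝔄.annih (η j) S j V) +
        𝔄.τ (star (𝔄.annih (η j) S j U) * 𝔄.ev S V)) →
      ∀ V, 𝔄.τ (star (𝔄.ev S (U * P)) * S j * 𝔄.ev S V) =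
      𝔄.τ (star (𝔄.ev S (U * P)) * 𝔄.annih (η j) S j V) +
        𝔄.τ (star (𝔄.annih (η j) S j (U * P)) * 𝔄.ev S V) := by
    intro P
    induction P using BPoly.induction with
    | hC b =>
      intro U hU V
      have h := hU (V * BPoly.C (star b))
      rw [annih_mul_C, map_mul (𝔄.ev S), ev_C, ← mul_assoc, ← mul_assoc, ← mul_assoc, 𝔄.τ_comm,
        𝔄.τ_comm _ (𝔄.incl _), 𝔄.τ_comm _ (𝔄.incl _)] at h
      rw [annih_mul_C, map_mul (𝔄.ev S), ev_C, star_mul, star_mul, ← map_star]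
      simpa only [mul_assoc] using h
    | hX i =>
      intro U hU V
      have h := hU (V * BPoly.X i)
      have hi : star (S i) = S i := (hS.2 i).1
      -- Moving X_i across creates one extra term from ∂_j on each side; τ-symmetry of η_j makes
      -- them equal.
      have hη : 𝔄.τ (star (𝔄.ev S U) * 𝔄.incl (η j (𝔄.E (𝔄.ev S V)))) =
          𝔄.τ (star (𝔄.incl (η j (𝔄.E (𝔄.ev S U)))) * 𝔄.ev S V) := by
        rw [τ_mul_incl, ← map_star 𝔄.incl, τ_incl_mul, ← (hS.2 j).τ_eta_mul, map_star 𝔄.E,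
          map_star]
      rw [annih_mul_X, map_mul (𝔄.ev S), ev_X, ← mul_assoc, mul_add, map_add, ← mul_assoc, ← mul_assoc,
        𝔄.τ_comm, 𝔄.τ_comm _ (S i), 𝔄.τ_comm _ (S i)] at h
      rw [annih_mul_X, map_mul (𝔄.ev S), ev_X, star_add, star_mul, star_mul, hi, add_mul, map_add]
      simp only [mul_assoc] at h ⊢
      have hη' : 𝔄.τ (star (𝔄.ev S U) *
            if i = j then 𝔄.incl (η j (𝔄.E (𝔄.ev S V))) else 0) =
          𝔄.τ (star (if i = j then 𝔄.incl (η j (𝔄.E (𝔄.ev S U))) else 0) * 𝔄.ev S V) := by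
        split_ifs
        · exact hη
        · simp
      rw [h, hη', add_right_comm, add_assoc]
    | hadd P Q hP hQ =>
      intro U hU V
      simp only [mul_add, map_add, star_add, add_mul, hP U hU V, hQ U hU V]
      ring
    | hmul P Q hP hQ => intro U hU; rw [← mul_assoc]; exact hQ _ (hP U hU)
  -- For `U = 1` the second term vanishes, and what remains is the Schwinger–Dyson equation under τ.
  have h := key U 1 fun V => by
    rw [map_one, star_one, one_mul, one_mul, annih_one, star_zero, zero_mul, map_zero, add_zero,
      ← 𝔄.τ_E, hS.E_mul_ev, 𝔄.τ_E]
  rw [one_mul] at h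
  exact h V

/-- `S_j` acts as the sum of the annihilation operator and of its adjoint. -/
theorem IsFreeSemicircularSystem.E_star_mul {η : Fin d → B →CP B}
    (hS : 𝔄.IsFreeSemicircularSystem η S) (j : Fin d) (U V : BPoly B (Fin d)) :
    𝔄.E (star (𝔄.ev S U) * S j * 𝔄.ev S V) = 𝔄.E (star (𝔄.ev S U) * 𝔄.annih (η j) S j V) +
      𝔄.E (star (𝔄.annih (η j) S j U) * 𝔄.ev S V) := by
  rw [← map_add]
  refine 𝔄.E_eq_of_τ fun b => ?_
  have h := hS.τ_star_mul 𝔄 j U (V * BPoly.C b)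
  rw [map_mul (𝔄.ev S), ev_C, annih_mul_C] at h
  simpa only [add_mul, map_add, mul_assoc] using h

end TracialSpace

/-! ### Algebra of Wick words -/

namespace BPoly

variable {B : Type*} [CStarAlgebra B] [PartialOrder B] [StarOrderedRing B]
  {ι : Type*} [DecidableEq ι] (η : ι → B →CP B)

/-- The Wick word of the monomial `b X_{i_1} c_1 ⋯ X_{i_n} c_n`, where the list consists of the pairs
`(i_m, c_m)`. -/
def wick : B → List (ι × B) → BPoly B ι
  | b, [] => C b
  | b, [(i, c)] => C b * X i * C c
  | b, (i, c) :: (i', c') :: l => C b * X i * wick c ((i', c') :: l) -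
      if i = i' then C b * wick (η i c * c') l else 0
  termination_by _ l => l.length

/-- The left annihilation operator on Wick words. -/
def wickAnnih (i : ι) (b : B) : List (ι × B) → BPoly B ι
  | [] => 0
  | (i', c) :: l => if i = i' then wick η (η i b * c) l else 0

@[simp] theorem wick_nil (b : B) : wick η b ([] : List (ι × B)) = C b := by rw [wick]

theorem wick_cons (b : B) (i : ι) (c : B) (l : List (ι × B)) :
    wick η b ((i, c) :: l) = C b * X i * wick η c l - C b * wickAnnih η i c l := by
  cases l with
  | nil => rw [wick_nil, wickAnnih, mul_zero, sub_zero, wick]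
  | cons p l => rw [wick, wickAnnih, mul_ite, mul_zero]

theorem C_mul_wick (a b : B) (l : List (ι × B)) : C a * wick η b l = wick η (a * b) l := by
  cases l with
  | nil => simp
  | cons p l => rw [wick_cons, wick_cons, mul_sub, map_mul]; simp only [mul_assoc]

theorem X_mul_wick (i : ι) (b : B) (l : List (ι × B)) :
    X i * wick η b l = wick η 1 ((i, b) :: l) + wickAnnih η i b l := by
  simp [wick_cons]

theorem wickAnnih_mem_span (i : ι) (b : B) (l : List (ι × B)) : wickAnnih η i b l ∈
    Submodule.span ℂ {P : BPoly B ι | ∃ b l, P = wick η b l} := by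
  cases l with
  | nil => exact Submodule.zero_mem _
  | cons p l =>
    rw [wickAnnih]
    split_ifs
    · exact Submodule.subset_span ⟨_, _, rfl⟩
    · exact Submodule.zero_mem _

/-- A letter times a Wick word is a longer Wick word plus an annihilated one, so the span is a left
ideal containing 1. -/
theorem mem_span_wick (P : BPoly B ι) :
    P ∈ Submodule.span ℂ {P : BPoly B ι | ∃ b l, P = wick η b l} := by
  set M := Submodule.span ℂ {P : BPoly B ι | ∃ b l, P = wick η b l}
  have red : ∀ P : BPoly B ι, (∀ b l, P * wick η b l ∈ M) → ∀ v ∈ M, P * v ∈ M := by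
    intro P h v hv
    induction hv using Submodule.span_induction with
    | mem v hv => obtain ⟨b, l, rfl⟩ := hv; exact h b l
    | zero => simp
    | add x y _ _ hx hy => rw [mul_add]; exact M.add_mem hx hy
    | smul r x _ hx => rw [mul_smul_comm]; exact M.smul_mem _ hx
  refine mem_of_mul_mem M (Submodule.subset_span ⟨1, [], by simp⟩) (fun a => red _ fun b l => ?_)
    (fun i => red _ fun b l => ?_) P
  · rw [C_mul_wick]
    exact Submodule.subset_span ⟨_, _, rfl⟩
  · rw [X_mul_wick]
    exact M.add_mem (Submodule.subset_span ⟨_, _, rfl⟩) (wickAnnih_mem_span η i b l)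

/-- The correction terms in the definition of `wick` are arranged so that cutting a Wick word leaves
Wick words on both legs: for cuts beyond the second letter, the correction on the left leg is the
one required by its own recursion. -/
theorem fdq_wick (j : ι) (b : B) (l : List (ι × B)) :
    fdq j (wick η b l) = ∑ k : Fin l.length, if l[k].1 = j then
      wick η b (l.take k) ⊗ₜ[ℂ] wick η l[k].2 (l.drop (k + 1)) else 0 := by
  have h1 : ∀ (b : B) (i : ι), fdq j (C b * X i) = if i = j then C b ⊗ₜ[ℂ] 1 else 0 := by
    intro b i
    rw [fdq_mul, fdq_C, zero_mul, add_zero, fdq_X]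
    split_ifs <;> simp
  obtain ⟨n, hn⟩ : ∃ n, n = l.length := ⟨_, rfl⟩
  induction n using Nat.strong_induction_on generalizing b l with
  | _ n ih =>
    subst hn
    match l with
    | [] => simp
    | [(i, c)] =>
      rw [wick, fdq_mul, fdq_C, mul_zero, zero_add, h1]
      simp [ite_mul]
    | (i, c) :: (i', c') :: l =>
      rw [wick, map_sub, fdq_mul, ih _ (by simp) c ((i', c') :: l) rfl, h1]
      have h2 : fdq j (if i = i' then C b * wick η (η i c * c') l else 0) =
          ∑ k : Fin l.length, if l[k].1 = j then
            (if i = i' then C b * wick η (η i c * c') (l.take k) else 0) ⊗ₜ[ℂ]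
              wick η l[k].2 (l.drop (k + 1)) else 0 := by
        split_ifs
        · rw [C_mul_wick, ih _ (by simp) _ l rfl]
          simp only [C_mul_wick]
        · simp
      rw [h2]
      simp only [List.length_cons]
      -- Cuts at the first two letters are split off, since their left legs are too short to carry a
      -- correction.
      rw [Fin.sum_univ_succ, Fin.sum_univ_succ, Fin.sum_univ_succ, add_comm, mul_add, add_sub_assoc,
        Finset.mul_sum, add_sub_assoc, ← Finset.sum_sub_distrib]
      congr 1
      · simp [ite_mul]
      congr 1
      · simp [wick, mul_ite]
      · refine Finset.sum_congr rfl fun k _ => ?_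
        simp only [Fin.val_succ, Fin.getElem_fin, List.getElem_cons_succ, List.take_succ_cons,
          List.drop_succ_cons]
        rw [wick, TensorProduct.sub_tmul]
        split_ifs <;> simp

/-- The `B`-valued inner product of two Wick words, with `x` between them. -/
def wickInner : B → List (ι × B) → List (ι × B) → B
  | x, [], [] => x
  | x, (i, c) :: l, (i', c') :: l' =>
    if i = i' then wickInner (star c * η i x * c') l l' else 0
  | _, _, _ => 0

theorem wickInner_of_length_ne (x : B) (l l' : List (ι × B)) (h : l.length ≠ l'.length) :
    wickInner η x l l' = 0 := by
  induction l generalizing x l' with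
  | nil =>
    cases l' with
    | nil => simp at h
    | cons p' l' => rw [wickInner]; all_goals simp
  | cons p l ih =>
    cases l' with
    | nil => rw [wickInner]; all_goals simp
    | cons p' l' =>
      rw [wickInner]
      split_ifs
      · exact ih _ _ (by simpa using h)
      · rfl

@[simp] theorem wickInner_zero (l l' : List (ι × B)) : wickInner η 0 l l' = 0 := by
  induction l generalizing l' with
  | nil => cases l' <;> simp [wickInner]
  | cons p l ih => cases l' <;> simp [wickInner, ih]

/-- Off the diagonal `k = k'` the prefixes have different lengths and the inner `wickInner` is 0. On
it, applying η_j at the cut is exactly the next step of the recursion, so each matching cut returns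
the full inner product. -/
theorem sum_wickInner (j : ι) (x : B) (l l' : List (ι × B)) :
    (∑ k : Fin l.length, ∑ k' : Fin l'.length, if l[k].1 = j then if l'[k'].1 = j then
      wickInner η (star l[k].2 * η j (wickInner η x (l.take k) (l'.take k')) * l'[k'].2)
        (l.drop (k + 1)) (l'.drop (k' + 1)) else 0 else 0) =
      (l.map Prod.fst).count j • wickInner η x l l' := by
  induction l generalizing x l' with
  | nil => simp
  | cons p l ih =>
    obtain ⟨i, c⟩ := p
    cases l' with
    | nil => simp [wickInner]
    | cons p' l' =>
      obtain ⟨i', c'⟩ := p'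
      simp only [List.length_cons]
      rw [Fin.sum_univ_succ]
      simp only [Fin.sum_univ_succ, Fin.val_succ, Fin.getElem_fin, List.getElem_cons_succ,
        List.take_succ_cons, List.drop_succ_cons, Fin.val_zero, List.getElem_cons_zero,
        List.take_zero, List.drop_zero, List.map_cons, List.count_cons]
      simp only [wickInner, map_zero, mul_zero, zero_mul, wickInner_zero, ite_self,
        Finset.sum_const_zero, add_zero, zero_add]
      have ih' := ih (star c * η i x * c') l'
      simp only [Fin.getElem_fin] at ih'
      by_cases h : i = i'
      · subst h
        simp only [if_true]
        rw [ih', add_smul, add_comm]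
        congr 1
        by_cases hj : i = j
        · subst hj; simp
        · simp [hj]
      · simp only [h, if_false, map_zero, mul_zero, zero_mul, wickInner_zero, ite_self,
          Finset.sum_const_zero, add_zero, smul_zero]
        split_ifs with h1 h2
        · exact absurd (h1.trans h2.symm) h
        · rfl
        · rfl

end BPoly

/-! ### Wick words evaluated at the semicircular system -/

namespace TracialSpace

variable {A B : Type*} [CStarAlgebra A] [PartialOrder A] [StarOrderedRing A]
  [CStarAlgebra B] [PartialOrder B] [StarOrderedRing B] (𝔄 : TracialSpace A B)
  {d : ℕ} {S : Fin d → A} {η : Fin d → B →CP B}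

open BPoly

/-- Only the cut at the first letter has a left leg of nonzero expectation. The vanishing is a
hypothesis on proper prefixes so that `E_wick` can use this inside its induction. -/
theorem annih_wick_of_E_eq_zero (j : Fin d) (b : B) (l : List (Fin d × B))
    (h : ∀ k < l.length, k ≠ 0 → 𝔄.E (𝔄.ev S (wick η b (l.take k))) = 0) :
    𝔄.annih (η j) S j (wick η b l) = 𝔄.ev S (wickAnnih η j b l) := by
  rw [annih_apply, fdq_wick, map_sum]
  cases l with
  | nil => simp [wickAnnih]
  | cons p l =>
    obtain ⟨i, c⟩ := p
    rw [List.length_cons] at h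
    simp only [List.length_cons]
    rw [Fin.sum_univ_succ, Finset.sum_eq_zero, add_zero, wickAnnih]
    · by_cases hij : j = i
      · subst hij
        simp [𝔄.E_incl, ← C_mul_wick]
      · simp [hij, Ne.symm hij]
    · intro k _
      rw [apply_ite (𝔄.etaLeft (η j) S), etaLeft_tmul, h _ (by simp) (by simp)]
      simp

/-- By Schwinger–Dyson, the expectation of S_i times the tail is that of the annihilated tail, which
is the correction subtracted in `wick_cons`. -/
theorem IsFreeSemicircularSystem.E_wick (hS : 𝔄.IsFreeSemicircularSystem η S) (b : B)
    (l : List (Fin d × B)) (hl : l ≠ []) : 𝔄.E (𝔄.ev S (wick η b l)) = 0 := by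
  obtain ⟨n, hn⟩ : ∃ n, n = l.length := ⟨_, rfl⟩
  induction n using Nat.strong_induction_on generalizing b l with
  | _ n ih =>
    subst hn
    obtain ⟨⟨i, c⟩, t, rfl⟩ := List.exists_cons_of_ne_nil hl
    rw [wick_cons, mul_assoc, ← mul_sub, map_mul, ev_C, E_incl_mul, map_sub, map_sub,
      map_mul (𝔄.ev S), ev_X, hS.E_mul_ev, annih_wick_of_E_eq_zero, sub_self, mul_zero]
    intro k hk hk0
    refine ih _ ?_ c (t.take k) ?_ rfl
    · simp
    · simp only [ne_eq, List.take_eq_nil_iff, not_or]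
      refine ⟨hk0, ?_⟩
      rintro rfl
      simp at hk

theorem IsFreeSemicircularSystem.annih_wick (hS : 𝔄.IsFreeSemicircularSystem η S) (j : Fin d)
    (b : B) (l : List (Fin d × B)) :
    𝔄.annih (η j) S j (wick η b l) = 𝔄.ev S (wickAnnih η j b l) := by
  refine 𝔄.annih_wick_of_E_eq_zero j b l fun k hk hk0 => hS.E_wick 𝔄 b _ ?_
  simp only [ne_eq, List.take_eq_nil_iff, not_or]
  refine ⟨hk0, ?_⟩
  rintro rfl
  simp at hk

/-- The `B`-valued inner products of Wick words. -/
theorem IsFreeSemicircularSystem.E_star_wick_mul_wick (hS : 𝔄.IsFreeSemicircularSystem η S)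
    (b b' : B) (l l' : List (Fin d × B)) :
    𝔄.E (star (𝔄.ev S (wick η b l)) * 𝔄.ev S (wick η b' l')) =
      wickInner η (star b * b') l l' := by
  induction l generalizing b b' l' with
  | nil =>
    rw [wick_nil, ev_C, ← map_star, ← 𝔄.ev_C S, ← map_mul, C_mul_wick]
    cases l' with
    | nil => rw [wick_nil, ev_C, 𝔄.E_incl, wickInner]
    | cons p' l' =>
      rw [hS.E_wick 𝔄 _ _ (by simp), wickInner_of_length_ne _ _ _ _ (by simp)]
  | cons p t ih =>
    obtain ⟨i, c⟩ := p
    have h1 : star (𝔄.ev S (wick η b ((i, c) :: t))) * 𝔄.ev S (wick η b' l') =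
        star (𝔄.ev S (wick η c t)) * S i * 𝔄.ev S (wick η (star b * b') l') -
          star (𝔄.ev S (wickAnnih η i c t)) * 𝔄.ev S (wick η (star b * b') l') := by
      have hi : star (S i) = S i := (hS.2 i).1
      rw [wick_cons, ← C_mul_wick η (star b)]
      simp only [map_sub, map_mul, ev_C, ev_X, star_sub, star_mul, hi, map_star, sub_mul, mul_assoc]
    -- The term where S_i annihilates the left word cancels its Wick correction; only annihilation
    -- of the right word remains.
    rw [h1, map_sub, hS.E_star_mul, hS.annih_wick, hS.annih_wick, add_sub_cancel_right]
    cases l' with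
    | nil =>
      rw [wickAnnih, map_zero, mul_zero, map_zero, wickInner_of_length_ne _ _ _ _ (by simp)]
    | cons p' l' =>
      obtain ⟨i', c'⟩ := p'
      rw [wickAnnih, wickInner]
      split_ifs
      · rw [ih, mul_assoc]
      · simp

/-- This is the spectral statement behind everything: ∂_j^*∂_j acts on Wick words as the number
operator of the letter `j`. -/
theorem IsFreeSemicircularSystem.etaInner_fdq_wick (hS : 𝔄.IsFreeSemicircularSystem η S)
    (j : Fin d) (b b' : B) (l l' : List (Fin d × B)) :
    𝔄.etaInner (η j) (𝔄.evTensor S (fdq j (wick η b l))) (𝔄.evTensor S (fdq j (wick η b' l'))) =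
      (l.map Prod.fst).count j *
        𝔄.τ (star (𝔄.ev S (wick η b l)) * 𝔄.ev S (wick η b' l')) := by
  have h1 : ∀ (n : ℕ) (f : Fin n → A ⊗[ℂ] A) y, 𝔄.etaInner (η j) (∑ i, f i) y =
      ∑ i, 𝔄.etaInner (η j) (f i) y := fun n f y => by simp [etaInner, star_sum]
  have h2 : ∀ (n : ℕ) (f : Fin n → A ⊗[ℂ] A) x, 𝔄.etaInner (η j) x (∑ i, f i) =
      ∑ i, 𝔄.etaInner (η j) x (f i) := fun n f y => by simp [etaInner]
  have h3 : ∀ y, 𝔄.etaInner (η j) 0 y = 0 := fun y => by simp [etaInner]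
  have h4 : ∀ y, 𝔄.etaInner (η j) y 0 = 0 := fun y => by simp [etaInner]
  have h5 : ∀ a₁ a₂ a₃ a₄ m₁ m₂ m₃ m₄, 𝔄.etaInner (η j)
      (𝔄.evTensor S (wick η a₁ m₁ ⊗ₜ wick η a₂ m₂)) (𝔄.evTensor S (wick η a₃ m₃ ⊗ₜ wick η a₄ m₄)) =
      𝔄.τ (𝔄.incl (wickInner η (star a₂ * η j (wickInner η (star a₁ * a₃) m₁ m₃) * a₄) m₂ m₄)) := by
    intro a₁ a₂ a₃ a₄ m₁ m₂ m₃ m₄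
    rw [evTensor, TensorProduct.map_tmul, TensorProduct.map_tmul, etaInner_tmul]
    simp only [AlgHom.toLinearMap_apply]
    rw [hS.E_star_wick_mul_wick, mul_assoc, ← 𝔄.ev_C S, ← map_mul, C_mul_wick, ← 𝔄.τ_E,
      hS.E_star_wick_mul_wick, mul_assoc]
  rw [← 𝔄.τ_E, hS.E_star_wick_mul_wick, ← nsmul_eq_mul, ← map_nsmul, ← map_nsmul,
    ← sum_wickInner η j]
  simp only [fdq_wick, map_sum, h1, h2]
  refine Finset.sum_congr rfl fun k _ => Finset.sum_congr rfl fun k' _ => ?_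
  split_ifs
  · exact h5 _ _ _ _ _ _ _ _
  · simp [h4]
  · simp [h3]
  · simp [h3]

end TracialSpace

/-! ### Hilbert space lemmas: closability and graded lower bounds -/

section Closability

variable {V H K : Type*} [AddCommGroup V] [Module ℂ V] [NormedAddCommGroup H]
  [InnerProductSpace ℂ H] [NormedAddCommGroup K] [InnerProductSpace ℂ K]

theorem norm_sum_sq_of_orthogonal {ι : Type*} (s : Finset ι) (x : ι → H)
    (h : ∀ i j, i ≠ j → inner ℂ (x i) (x j) = 0) : ‖∑ i ∈ s, x i‖ ^ 2 = ∑ i ∈ s, ‖x i‖ ^ 2 := by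
  rw [← Complex.ofReal_inj]
  push_cast
  rw [← Complex.coe_algebraMap, ← inner_self_eq_norm_sq_to_K (𝕜 := ℂ), sum_inner]
  refine Finset.sum_congr rfl fun i hi => ?_
  rw [inner_sum, Finset.sum_eq_single i (fun j _ hj => h i j hj.symm) (fun hn => absurd hi hn),
    inner_self_eq_norm_sq_to_K (𝕜 := ℂ)]

variable {u : V →ₗ[ℂ] H} {D : V →ₗ[ℂ] K}

/-- The hypothesis says that each `D Q` lies in the domain of the adjoint. The resulting identity is
closed in the graph, so a vertical vector is orthogonal to the range of `D`; its second component
also lies in the closure of that range, hence is 0. -/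
theorem eq_zero_of_mem_closure_graph
    (h : ∀ Q, ∃ Q', ∀ P, inner ℂ (D Q) (D P) = inner ℂ (u Q') (u P)) (p : H × K)
    (hp : p ∈ (LinearMap.range (u.prod D)).topologicalClosure) (h1 : p.1 = 0) : p.2 = 0 := by
  have hp' : p ∈ closure (LinearMap.range (u.prod D) : Set (H × K)) := hp
  have key : ∀ Q, inner ℂ (D Q) p.2 = 0 := by
    intro Q
    obtain ⟨Q', hQ'⟩ := h Q
    have hcl : IsClosed {q : H × K | inner ℂ (D Q) q.2 = inner ℂ (u Q') q.1} :=
      isClosed_eq (by fun_prop) (by fun_prop)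
    have := closure_minimal (t := {q : H × K | inner ℂ (D Q) q.2 = inner ℂ (u Q') q.1})
      (by rintro _ ⟨P, rfl⟩; exact hQ' P) hcl hp'
    rw [Set.mem_ofPred_eq, h1, inner_zero_right] at this
    exact this
  have hcl : IsClosed {q : H × K | inner ℂ q.2 p.2 = 0} :=
    isClosed_eq (by fun_prop) (by fun_prop)
  have := closure_minimal (t := {q : H × K | inner ℂ q.2 p.2 = 0})
      (by rintro _ ⟨P, rfl⟩; exact key P) hcl hp'
  exact inner_self_eq_zero.mp this

theorem graph_toLinearPMap_range
    (h : ∀ Q, ∃ Q', ∀ P, inner ℂ (D Q) (D P) = inner ℂ (u Q') (u P)) :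
    (LinearMap.range (u.prod D)).toLinearPMap.graph = LinearMap.range (u.prod D) :=
  Submodule.toLinearPMap_graph_eq _ fun p hp h1 =>
    eq_zero_of_mem_closure_graph h p (Submodule.le_topologicalClosure _ hp) h1

theorem isClosable_toLinearPMap_range
    (h : ∀ Q, ∃ Q', ∀ P, inner ℂ (D Q) (D P) = inner ℂ (u Q') (u P)) :
    (LinearMap.range (u.prod D)).toLinearPMap.IsClosable :=
  ⟨(LinearMap.range (u.prod D)).topologicalClosure.toLinearPMap, by
    rw [graph_toLinearPMap_range h, Submodule.toLinearPMap_graph_eq _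
      (eq_zero_of_mem_closure_graph h)]⟩

/-- It suffices that generators be eigenvectors in the weak sense: `c` may depend on `w` but not on
`w'`, so a multiple of `w` represents the functional. -/
theorem exists_inner_of_span {G : Set V} (hG : ∀ P, P ∈ Submodule.span ℂ G)
    (h : ∀ w ∈ G, ∃ c : ℂ, ∀ w' ∈ G, inner ℂ (D w) (D w') = c * inner ℂ (u w) (u w')) (Q : V) :
    ∃ Q', ∀ P, inner ℂ (D Q) (D P) = inner ℂ (u Q') (u P) := by
  induction hG Q using Submodule.span_induction with
  | zero => exact ⟨0, fun P => by simp⟩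
  | add x y _ _ hx hy =>
    obtain ⟨x', hx⟩ := hx
    obtain ⟨y', hy⟩ := hy
    exact ⟨x' + y', fun P => by rw [map_add, map_add, inner_add_left, inner_add_left, hx, hy]⟩
  | smul r x _ hx =>
    obtain ⟨x', hx⟩ := hx
    exact ⟨r • x', fun P => by rw [map_smul, map_smul, inner_smul_left, inner_smul_left, hx]⟩
  | mem w hw =>
    obtain ⟨c, hc⟩ := h w hw
    refine ⟨(starRingEnd ℂ) c • w, fun P => ?_⟩
    induction hG P using Submodule.span_induction with
    | zero => simp
    | add x y _ _ hx hy =>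
      rw [map_add, map_add, inner_add_right, inner_add_right, hx, hy]
    | smul r x _ hx => rw [map_smul D r x, map_smul u r x, inner_smul_right, inner_smul_right, hx]
    | mem w' hw' => rw [hc w' hw', map_smul, inner_smul_left, Complex.conj_conj]

theorem inner_eq_of_mem_span {G G' : Set V} {c : ℂ}
    (h : ∀ w ∈ G, ∀ w' ∈ G', inner ℂ (D w) (D w') = c * inner ℂ (u w) (u w')) {P Q : V}
    (hP : P ∈ Submodule.span ℂ G) (hQ : Q ∈ Submodule.span ℂ G') :
    inner ℂ (D P) (D Q) = c * inner ℂ (u P) (u Q) := by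
  induction hP using Submodule.span_induction with
  | zero => simp
  | add x y _ _ hx hy => simp only [map_add, inner_add_left, hx, hy, mul_add]
  | smul r x _ hx => simp only [map_smul, inner_smul_left, hx, mul_left_comm]
  | mem P hP =>
    induction hQ using Submodule.span_induction with
    | zero => simp
    | add x y _ _ hx hy => simp only [map_add, inner_add_right, hx, hy, mul_add]
    | smul r x _ hx => simp only [map_smul, inner_smul_right, hx, mul_left_comm]
    | mem Q hQ => exact h P hP Q hQ

/-- If `D` multiplies the squared norms of the orthogonal components of degree `n` by `n`, then its
norm dominates the norm of the projection `u₀` onto the components of positive degree. -/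
theorem norm_sq_le_of_graded {G : ℕ → Set V} (hG : ∀ P, P ∈ ⨆ n, Submodule.span ℂ (G n))
    (hD : ∀ n m, ∀ w ∈ G n, ∀ w' ∈ G m, inner ℂ (D w) (D w') = n * inner ℂ (u w) (u w'))
    (hu : ∀ n m, n ≠ m → ∀ w ∈ G n, ∀ w' ∈ G m, inner ℂ (u w) (u w') = 0)
    (u₀ : V →ₗ[ℂ] H) (h₀ : ∀ n, ∀ w ∈ G n, u₀ w = if n = 0 then 0 else u w) (P : V) :
    ‖u₀ P‖ ^ 2 ≤ ‖D P‖ ^ 2 := by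
  have hu' : ∀ n m, n ≠ m → ∀ P ∈ Submodule.span ℂ (G n), ∀ Q ∈ Submodule.span ℂ (G m),
      inner ℂ (u P) (u Q) = 0 := fun n m hnm P hP Q hQ => by
    rw [inner_eq_of_mem_span (c := 0) (u := u) (by simpa using hu n m hnm) hP hQ, zero_mul]
  have h₀' : ∀ n, ∀ P ∈ Submodule.span ℂ (G n), u₀ P = if n = 0 then 0 else u P := by
    intro n P hP
    induction hP using Submodule.span_induction with
    | zero => simp
    | add x y _ _ hx hy => rw [map_add, hx, hy]; split_ifs <;> simp
    | smul r x _ hx => rw [map_smul, hx]; split_ifs <;> simp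
    | mem w hw => exact h₀ n w hw
  obtain ⟨f, hf, rfl⟩ := Submodule.mem_iSup_iff_exists_finsupp _ _ |>.mp (hG P)
  have hD' := fun n m => inner_eq_of_mem_span (hD n m) (hf n) (hf m)
  have h1 : ∀ n, ‖D (f n)‖ ^ 2 = n * ‖u (f n)‖ ^ 2 := fun n => by
    have := hD' n n
    rw [inner_self_eq_norm_sq_to_K, inner_self_eq_norm_sq_to_K] at this
    refine Complex.ofReal_injective ?_
    push_cast
    exact this
  have h2 : ∀ n, u₀ (f n) = if n = 0 then 0 else u (f n) := fun n => h₀' n _ (hf n)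
  rw [Finsupp.sum, map_sum, map_sum, norm_sum_sq_of_orthogonal, norm_sum_sq_of_orthogonal]
  · refine Finset.sum_le_sum fun n _ => ?_
    rw [h1, h2]
    split_ifs with h
    · simp [h]
    · have : (1 : ℝ) ≤ n := by exact_mod_cast Nat.one_le_iff_ne_zero.mpr h
      exact le_mul_of_one_le_left (sq_nonneg _) this
  · intro n m hnm
    rw [hD', hu' n m hnm _ (hf n) _ (hf m), mul_zero]
  · intro n m hnm
    rw [h2, h2]
    split_ifs
    · simp
    · simp
    · simp
    · exact hu' n m hnm _ (hf n) _ (hf m)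

end Closability

/-! ### The Poincaré inequality and the closed operators -/

namespace TracialSpace

variable {A B : Type*} [CStarAlgebra A] [PartialOrder A] [StarOrderedRing A]
  [CStarAlgebra B] [PartialOrder B] [StarOrderedRing B] (𝔄 : TracialSpace A B)
  {d : ℕ} (S : Fin d → A) (η : Fin d → B →CP B)

open BPoly

theorem inner_toL2 (a a' : A) : inner ℂ (𝔄.toL2 a) (𝔄.toL2 a') = 𝔄.τ (star a * a') :=
  UniformSpace.Completion.inner_coe _ _

theorem inner_evL2 (P Q : BPoly B (Fin d)) :
    inner ℂ (𝔄.evL2 S P) (𝔄.evL2 S Q) = 𝔄.τ (star (𝔄.ev S P) * 𝔄.ev S Q) :=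
  𝔄.inner_toL2 _ _

theorem inner_fdqL2 (j : Fin d) (P Q : BPoly B (Fin d)) :
    inner ℂ (𝔄.fdqL2 η S j P) (𝔄.fdqL2 η S j Q) =
      𝔄.etaInner (η j) (𝔄.evTensor S (fdq j P)) (𝔄.evTensor S (fdq j Q)) :=
  𝔄.inner_toL2Eta _ _ _

theorem gradL2_apply (P : BPoly B (Fin d)) (j : Fin d) :
    𝔄.gradL2 η S P j = 𝔄.fdqL2 η S j P := rfl

theorem inner_gradL2 (P Q : BPoly B (Fin d)) : inner ℂ (𝔄.gradL2 η S P) (𝔄.gradL2 η S Q) =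
    ∑ j, inner ℂ (𝔄.fdqL2 η S j P) (𝔄.fdqL2 η S j Q) :=
  PiLp.inner_apply _ _

theorem condExp_mem_L2B (x : 𝔄.L2) : 𝔄.condExp x ∈ 𝔄.L2B := by
  induction x using UniformSpace.Completion.induction_on with
  | hp => exact (Submodule.isClosed_topologicalClosure _).preimage 𝔄.condExp.continuous
  | ih a =>
    have := 𝔄.condExp_toL2 (𝔄.τ.ofPreGNS a)
    have h : 𝔄.toL2 (𝔄.τ.ofPreGNS a) = (a : 𝔄.L2) := rfl
    rw [← h, this]
    exact Submodule.le_topologicalClosure _ ⟨_, rfl⟩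

variable {S η}

theorem IsFreeSemicircularSystem.exists_inner_fdqL2 (hS : 𝔄.IsFreeSemicircularSystem η S)
    (j : Fin d) (Q : BPoly B (Fin d)) : ∃ Q', ∀ P,
      inner ℂ (𝔄.fdqL2 η S j Q) (𝔄.fdqL2 η S j P) = inner ℂ (𝔄.evL2 S Q') (𝔄.evL2 S P) := by
  refine exists_inner_of_span (mem_span_wick η) ?_ Q
  rintro _ ⟨b, l, rfl⟩
  refine ⟨(l.map Prod.fst).count j, ?_⟩
  rintro _ ⟨b', l', rfl⟩
  rw [inner_evL2, ← hS.etaInner_fdq_wick]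
  exact 𝔄.inner_fdqL2 S η j _ _

theorem IsFreeSemicircularSystem.exists_inner_gradL2 (hS : 𝔄.IsFreeSemicircularSystem η S)
    (Q : BPoly B (Fin d)) : ∃ Q', ∀ P,
      inner ℂ (𝔄.gradL2 η S Q) (𝔄.gradL2 η S P) = inner ℂ (𝔄.evL2 S Q') (𝔄.evL2 S P) := by
  choose Q' hQ' using fun j => hS.exists_inner_fdqL2 𝔄 j Q
  exact ⟨∑ j, Q' j, fun P => by simp only [inner_gradL2, hQ', map_sum, sum_inner]⟩

theorem sum_count {d : ℕ} {B : Type*} (l : List (Fin d × B)) :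
    ∑ j, (l.map Prod.fst).count j = l.length := by
  induction l with
  | nil => simp
  | cons p l ih => simp [List.count_cons, Finset.sum_add_distrib, ih]

/-- The Poincaré inequality for polynomials. -/
theorem IsFreeSemicircularSystem.poincare (hS : 𝔄.IsFreeSemicircularSystem η S)
    (P : BPoly B (Fin d)) : ‖(𝔄.evL2 S P : 𝔄.L2) - 𝔄.condExp (𝔄.evL2 S P : 𝔄.L2)‖ ^ 2 ≤
      ‖𝔄.gradL2 η S P‖ ^ 2 := by
  refine norm_sq_le_of_graded (K := 𝔄.L2PolyTensorSum η S)
    (u := 𝔄.toL2 ∘ₗ (𝔄.ev S).toLinearMap) (D := 𝔄.gradL2 η S)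
    (G := fun n => {P | ∃ b l, l.length = n ∧ P = wick η b l}) (fun P => ?_) ?_ ?_
    ((LinearMap.id - 𝔄.condExp.toLinearMap : 𝔄.L2 →ₗ[ℂ] 𝔄.L2) ∘ₗ
      𝔄.toL2 ∘ₗ (𝔄.ev S).toLinearMap) ?_ P
  · refine Submodule.span_le.mpr ?_ (mem_span_wick η P)
    rintro _ ⟨b, l, rfl⟩
    exact Submodule.mem_iSup_of_mem l.length (Submodule.subset_span ⟨b, l, rfl, rfl⟩)
  · rintro n m _ ⟨b, l, rfl, rfl⟩ _ ⟨b', l', rfl, rfl⟩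
    refine (𝔄.inner_gradL2 S η _ _).trans ?_
    simp only [inner_fdqL2, hS.etaInner_fdq_wick]
    -- The letter counts add up to the length of the word, which is the degree in the grading.
    rw [← Finset.sum_mul, ← Nat.cast_sum, sum_count]
    congr 1
    exact (𝔄.inner_toL2 _ _).symm
  · rintro n m hnm _ ⟨b, l, rfl, rfl⟩ _ ⟨b', l', rfl, rfl⟩
    refine (𝔄.inner_toL2 _ _).trans ?_
    rw [← 𝔄.τ_E]
    refine (congrArg (fun x => 𝔄.τ (𝔄.incl x)) (hS.E_star_wick_mul_wick 𝔄 b b' l l')).trans ?_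
    rw [wickInner_of_length_ne _ _ _ _ hnm, map_zero, map_zero]
  · rintro n _ ⟨b, l, rfl, rfl⟩
    change 𝔄.toL2 (𝔄.ev S (wick η b l)) - 𝔄.condExp (𝔄.toL2 (𝔄.ev S (wick η b l))) =
      if _ then 0 else 𝔄.toL2 (𝔄.ev S (wick η b l))
    rw [condExp_toL2, ← map_sub]
    split_ifs with h
    · rw [List.length_eq_zero_iff] at h
      rw [h, wick_nil, ev_C, 𝔄.E_incl, sub_self, map_zero]
    · rw [hS.E_wick 𝔄 b l (by rintro rfl; simp at h), map_zero, sub_zero]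

end TracialSpace

namespace TracialSpace

variable {A B : Type*} [CStarAlgebra A] [PartialOrder A] [StarOrderedRing A]
  [CStarAlgebra B] [PartialOrder B] [StarOrderedRing B] (𝔄 : TracialSpace A B)
  {d : ℕ} {S : Fin d → A} {η : Fin d → B →CP B}

open BPoly

theorem IsFreeSemicircularSystem.graph_partialOp (hS : 𝔄.IsFreeSemicircularSystem η S)
    (j : Fin d) : (𝔄.partialOp η S j).graph = LinearMap.range ((𝔄.evL2 S).prod (𝔄.fdqL2 η S j)) :=
  graph_toLinearPMap_range (hS.exists_inner_fdqL2 𝔄 j)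

theorem IsFreeSemicircularSystem.graph_gradOp (hS : 𝔄.IsFreeSemicircularSystem η S) :
    (𝔄.gradOp η S).graph = LinearMap.range ((𝔄.evL2 S).prod (𝔄.gradL2 η S)) :=
  graph_toLinearPMap_range (K := 𝔄.L2PolyTensorSum η S) (hS.exists_inner_gradL2 𝔄)

theorem IsFreeSemicircularSystem.isClosable_partialOp (hS : 𝔄.IsFreeSemicircularSystem η S)
    (j : Fin d) : (𝔄.partialOp η S j).IsClosable :=
  isClosable_toLinearPMap_range (hS.exists_inner_fdqL2 𝔄 j)

theorem IsFreeSemicircularSystem.isClosable_gradOp (hS : 𝔄.IsFreeSemicircularSystem η S) :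
    (𝔄.gradOp η S).IsClosable :=
  isClosable_toLinearPMap_range (K := 𝔄.L2PolyTensorSum η S) (hS.exists_inner_gradL2 𝔄)

/-- Closability guarantees that `LinearPMap.closure` has the topological closure as its graph, so
closed conditions need only be checked on polynomials. -/
theorem IsFreeSemicircularSystem.mem_graph_closure_partialOp
    (hS : 𝔄.IsFreeSemicircularSystem η S) (j : Fin d) (p : 𝔄.L2Poly S × 𝔄.L2PolyTensor η S j) :
    p ∈ (𝔄.partialOp η S j).closure.graph ↔
      p ∈ closure (Set.range fun P => (𝔄.evL2 S P, 𝔄.fdqL2 η S j P)) := by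
  rw [← (hS.isClosable_partialOp 𝔄 j).graph_closure_eq_closure_graph, hS.graph_partialOp]
  rfl

theorem IsFreeSemicircularSystem.mem_graph_closure_gradOp
    (hS : 𝔄.IsFreeSemicircularSystem η S) (p : 𝔄.L2Poly S × 𝔄.L2PolyTensorSum η S) :
    p ∈ (𝔄.gradOp η S).closure.graph ↔
      p ∈ closure (Set.range fun P => (𝔄.evL2 S P, 𝔄.gradL2 η S P)) := by
  rw [← (hS.isClosable_gradOp 𝔄).graph_closure_eq_closure_graph, hS.graph_gradOp]
  rfl

/-- The coordinate projection is continuous and maps the graph of the gradient into that of its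
`j`-th component, hence also their closures. -/
theorem IsFreeSemicircularSystem.apply_mem_graph_closure_partialOp
    (hS : 𝔄.IsFreeSemicircularSystem η S) (ξ : (𝔄.gradOp η S).closure.domain) (j : Fin d) :
    ((ξ : 𝔄.L2Poly S), (𝔄.gradOp η S).closure ξ j) ∈ (𝔄.partialOp η S j).closure.graph := by
  have h := (hS.mem_graph_closure_gradOp 𝔄 _).mp (LinearPMap.mem_graph _ ξ)
  rw [hS.mem_graph_closure_partialOp]
  have hc : Continuous fun p : 𝔄.L2Poly S × 𝔄.L2PolyTensorSum η S => (p.1, p.2 j) :=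
    continuous_fst.prodMk ((PiLp.continuous_apply 2 _ j).comp continuous_snd)
  refine map_mem_closure (f := fun p : 𝔄.L2Poly S × 𝔄.L2PolyTensorSum η S => (p.1, p.2 j)) hc h ?_
  rintro _ ⟨P, rfl⟩
  exact ⟨P, rfl⟩

/-- The Poincaré inequality on the domain of the closure. -/
theorem IsFreeSemicircularSystem.poincare_closure
    (hS : 𝔄.IsFreeSemicircularSystem η S) (ξ : (𝔄.gradOp η S).closure.domain) :
    ‖((ξ : 𝔄.L2Poly S) : 𝔄.L2) - 𝔄.condExp ((ξ : 𝔄.L2Poly S) : 𝔄.L2)‖ ^ 2 ≤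
      ‖(𝔄.gradOp η S).closure ξ‖ ^ 2 := by
  have h := (hS.mem_graph_closure_gradOp 𝔄 _).mp (LinearPMap.mem_graph _ ξ)
  have hc : IsClosed {p : 𝔄.L2Poly S × 𝔄.L2PolyTensorSum η S |
      ‖(p.1 : 𝔄.L2) - 𝔄.condExp (p.1 : 𝔄.L2)‖ ^ 2 ≤ ‖p.2‖ ^ 2} := by
    refine isClosed_le ?_ (continuous_snd.norm.pow 2)
    have h1 : Continuous fun p : 𝔄.L2Poly S × 𝔄.L2PolyTensorSum η S => (p.1 : 𝔄.L2) :=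
      continuous_subtype_val.comp continuous_fst
    exact (h1.sub (𝔄.condExp.continuous.comp h1)).norm.pow 2
  exact closure_minimal (by rintro _ ⟨P, rfl⟩; exact hS.poincare 𝔄 P) hc h

variable (S) in
theorem L2B_le_L2Poly : 𝔄.L2B ≤ 𝔄.L2Poly S := by
  refine Submodule.topologicalClosure_mono ?_
  rintro _ ⟨b, rfl⟩
  refine ⟨C b, ?_⟩
  change 𝔄.toL2 (𝔄.ev S (C b)) = 𝔄.toL2 (𝔄.incl b)
  rw [ev_C]

theorem IsFreeSemicircularSystem.mem_graph_closure_gradOp_of_mem_L2B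
    (hS : 𝔄.IsFreeSemicircularSystem η S) {x : 𝔄.L2} (hx : x ∈ 𝔄.L2B) :
    ((⟨x, 𝔄.L2B_le_L2Poly S hx⟩, 0) : 𝔄.L2Poly S × 𝔄.L2PolyTensorSum η S) ∈
      (𝔄.gradOp η S).closure.graph := by
  rw [hS.mem_graph_closure_gradOp]
  obtain ⟨a, ha, hlim⟩ := mem_closure_iff_seq_limit.mp
    (show x ∈ closure (LinearMap.range (𝔄.toL2 ∘ₗ 𝔄.incl.toAlgHom.toLinearMap) : Set 𝔄.L2) from hx)
  choose b hb using ha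
  have h0 : ∀ b, 𝔄.gradL2 η S (C b) = 0 := fun b => by
    ext j : 1
    rw [gradL2_apply]
    refine Subtype.ext ?_
    change 𝔄.toL2Eta (η j) (𝔄.evTensor S (fdq j (C b))) = 0
    rw [fdq_C, map_zero, map_zero]
  -- Constant polynomials approximate `x` while their gradients stay 0.
  refine mem_closure_of_tendsto (f := fun n => (𝔄.evL2 S (C (b n)), 𝔄.gradL2 η S (C (b n))))
    (b := Filter.atTop) ?_ (Filter.Eventually.of_forall fun n => ⟨C (b n), rfl⟩)
  simp only [h0]
  refine Filter.Tendsto.prodMk_nhds ?_ tendsto_const_nhds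
  rw [tendsto_subtype_rng]
  refine hlim.congr fun n => ?_
  rw [← hb]
  change 𝔄.toL2 (𝔄.incl (b n)) = 𝔄.toL2 (𝔄.ev S (C (b n)))
  rw [ev_C]

end TracialSpace

end OpValued

end

open OpValued in
theorem mainTheorem3 {A B : Type*} [CStarAlgebra A] [PartialOrder A] [StarOrderedRing A]
    [CStarAlgebra B] [PartialOrder B] [StarOrderedRing B] (𝔄 : TracialSpace A B)
    {d : ℕ} (η : Fin d → B →CP B) (S : Fin d → A) (hS : 𝔄.IsFreeSemicircularSystem η S) :
    ((∀ j P, (𝔄.evL2 S P, 𝔄.fdqL2 η S j P) ∈ (𝔄.partialOp η S j).graph) ∧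
      ∀ P, (𝔄.evL2 S P, 𝔄.gradL2 η S P) ∈ (𝔄.gradOp η S).graph) ∧
    ((∀ j, (𝔄.partialOp η S j).IsClosable) ∧ (𝔄.gradOp η S).IsClosable) ∧
    (∀ ξ : (𝔄.gradOp η S).closure.domain,
      ∃ hξ : ∀ j, (ξ : 𝔄.L2Poly S) ∈ (𝔄.partialOp η S j).closure.domain,
        ‖((ξ : 𝔄.L2Poly S) : 𝔄.L2) - 𝔄.condExp ((ξ : 𝔄.L2Poly S) : 𝔄.L2)‖ ^ 2
            ≤ ∑ j, ‖(𝔄.partialOp η S j).closure ⟨ξ, hξ j⟩‖ ^ 2 ∧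
        ∑ j, ‖(𝔄.partialOp η S j).closure ⟨ξ, hξ j⟩‖ ^ 2 = ‖(𝔄.gradOp η S).closure ξ‖ ^ 2) ∧
    {x : 𝔄.L2 | ∃ ξ : (𝔄.gradOp η S).closure.domain,
      (𝔄.gradOp η S).closure ξ = 0 ∧ ((ξ : 𝔄.L2Poly S) : 𝔄.L2) = x} = (𝔄.L2B : Set 𝔄.L2) := by
  refine ⟨⟨fun j P => ?_, fun P => ?_⟩, ⟨hS.isClosable_partialOp 𝔄, hS.isClosable_gradOp 𝔄⟩,
    fun ξ => ?_, ?_⟩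
  · rw [hS.graph_partialOp]
    exact ⟨P, rfl⟩
  · rw [hS.graph_gradOp]
    exact ⟨P, rfl⟩
  -- One graph membership yields both that ξ lies in each component's domain and that the
  -- component's value is the `j`-th coordinate of the gradient.
  · have hξ := fun j => (LinearPMap.mem_graph_iff _).mp (hS.apply_mem_graph_closure_partialOp 𝔄 ξ j)
    have hdom : ∀ j, (ξ : 𝔄.L2Poly S) ∈ (𝔄.partialOp η S j).closure.domain := fun j => by
      obtain ⟨y, hy, -⟩ := hξ j
      have hy' : (y : 𝔄.L2Poly S) = ξ := hy
      exact hy' ▸ y.2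
    have hsum : ∑ j, ‖(𝔄.partialOp η S j).closure ⟨ξ, hdom j⟩‖ ^ 2 =
        ‖(𝔄.gradOp η S).closure ξ‖ ^ 2 := by
      rw [PiLp.norm_sq_eq_of_L2]
      refine Finset.sum_congr rfl fun j _ => ?_
      obtain ⟨y, hy, hy'⟩ := hξ j
      rw [show (⟨ξ, hdom j⟩ : (𝔄.partialOp η S j).closure.domain) = y from Subtype.ext hy.symm, hy']
    exact ⟨hdom, hsum ▸ hS.poincare_closure 𝔄 ξ, hsum⟩
  · ext x
    constructor
    · rintro ⟨ξ, hξ, rfl⟩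
      -- Zero gradient forces ξ = E[ξ], and the extended `E` takes values in L²(B, τ).
      have h := hS.poincare_closure 𝔄 ξ
      rw [hξ, norm_zero, zero_pow two_ne_zero] at h
      have h0 := pow_eq_zero_iff two_ne_zero |>.mp (le_antisymm h (sq_nonneg _))
      rw [sub_eq_zero.mp (norm_eq_zero.mp h0)]
      exact 𝔄.condExp_mem_L2B _
    · intro hx
      obtain ⟨ξ, h1, h2⟩ :=
        (LinearPMap.mem_graph_iff _).mp (hS.mem_graph_closure_gradOp_of_mem_L2B 𝔄 hx)
      exact ⟨ξ, h2, congrArg Subtype.val h1⟩
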